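/- **Setting.** A *network* $\mathcal N$ between two points $s,t\in\mathbb R^2$ consists of finitely many links (curves of finite length) and finitely many routes (curves of finite length from $s$ to $t$, each made up of links). A disaster area is the right half plane $R_G$ of a random directed line $G$: lines have coordinates $(\rho,\theta)$, $\rho\ge 0$, $-\pi\le\theta\le\pi$ ($\rho$ the distance from the origin, $\theta$ the angle of the perpendicular), $m$ is the motion-invariant measure $d\rho\,d\theta$ with both directions of a line having weight $1/2$, and for a bounded convex area $\Omega\supseteq\mathcal N$ one puts $\Pr(X)=m(X,\,G\cap\Omega\ne\emptyset)/m(G\cap\Omega\neq\emptyset)$. Let $0<r<1$. For $\varepsilon>0$ divide each link, from its start on, alternately into protected parts of length $r\varepsilon$ and unprotected parts of length $(1-r)\varepsilon$. A link is disconnected if $R_G$ meets one of its unprotected parts; $s\leftrightarrow t$ holds if some route has no disconnected link. *Under the weakest arrangement*, $\Pr(s\leftrightarrow t)$ is the limit of this probability as $\varepsilon\to0^+$. A point $p$ *lies between* two curves with common ends if it is on neither of them and one cannot be deformed into the other with fixed ends without sweeping over $p$ (i.e. the closed curve formed by them winds around $p$). Suppose that $\mathcal N$ has two *outer routes* $\mathcal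 O_1\ne\mathcal O_2$: simple curves, each meeting every other route only at $s,t$, such that every route lies in the area enclosed by $\mathcal O_1$ and $\mathcal O_2$, i.e. each of its points is on $\mathcal O_1\cup\mathcal O_2$ or between $\mathcal O_1$ and $\mathcal O_2$. Let $l(s,t)$ be the segment from $s$ to $t$, and let $I_1$ (resp. $I_2$), the *inner parts*, be the set of points of $\mathcal O_1$ (resp. $\mathcal O_2$) that lie between the other outer route and $l(s,t)$. $\mathcal N$ is *almost convex* if $s,t\in\partial\,\mathrm{conv}(\mathcal O_1\cup\mathcal O_2)$. For a convex set $C$, $L(C)$ is its perimeter length; for a segment this is twice its length. **Statement.** Let $\mathcal N$ be almost convex (with outer routes $\mathcal O_1,\mathcal O_2$ as above). Then there is a network $\mathcal N_0$ consisting of one single route from $s$ to $t$ (a curve of finite length, which may retrace its straight pieces) such that 1. $\mathcal N_0$ consists of $I_1$, $I_2$ and line segments connecting them and $s$ and $t$: its point set is the union of $I_1\cup I_2$ and finitely many line segments, each with its ends among $s$, $t$ and the end points of the inner parts (the points of $\overline{I_1\cup I_2}\setminus(I_1\cup I_2)$), and it runs through each point of $I_1\cup I_2$ exactly once; 2. for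 every bounded convex $\Omega\supseteq\mathcal N$ and every $0<r<1$, also $\mathcal N_0\subseteq\Omega$, and under the weakest arrangement $\Pr(s\leftrightarrow t)$ exists for $\mathcal N$ and for $\mathcal N_0$ and has the same value for both; 3. $\displaystyle\sum_{i=1}^{2}L\bigl(\mathrm{conv}(I_i\cup l(s,t))\bigr)=L\bigl(\mathrm{conv}(\mathcal N_0)\bigr)+L\bigl(l(s,t)\bigr).$ -/

import Mathlib

open Set Filter Topology MeasureTheory
open scoped ENNReal unitInterval

noncomputable section

/-- The Euclidean plane. -/
abbrev Plane : Type := EuclideanSpace ℝ (Fin 2)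

/-! ### Perimeter -/

/-- Perimeter length of a convex set of the plane: the length (one-dimensional Hausdorff measure) of
its boundary; a convex set without interior points (a segment) is a doubly covered curve, so that
the perimeter of the segment `l(x, y)` is `2 * |x - y|`, as usual in integral geometry. -/
def perimeter (C : Set Plane) : ℝ≥0∞ :=
  open Classical in
  if (interior C).Nonempty then μH[1] (frontier C) else 2 * μH[1] C

/-! ### Random directed lines and disasters -/

/-- Coordinates `(ρ, θ, σ)` of a directed line: `ρ ≥ 0` is the distance from the origin, `θ` the angle
between the perpendicular of the line and the positive `x`-axis, and `σ` one of the two directions. -/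
abbrev DirLine : Type := ℝ × ℝ × Bool

/-- The unit vector of angle `θ`. -/
def unitVec (θ : ℝ) : Plane := !₂[Real.cos θ, Real.sin θ]

/-- The points of the line `G`. -/
def linePoints (G : DirLine) : Set Plane := {x | inner ℝ x (unitVec G.2.1) = G.1}

/-- The (open) right half plane `R_G` of the directed line `G`. The two directions of a line
give its two sides. -/
def rightHalfPlane (G : DirLine) : Set Plane :=
  if G.2.2 then {x | G.1 < inner ℝ x (unitVec G.2.1)} else {x | inner ℝ x (unitVec G.2.1) < G.1}

/-- The motion-invariant measure `dρ dθ` on lines (`0 ≤ ρ`, `-π ≤ θ ≤ π`), both directions of a line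
having weight `1/2`. -/
def lineMeasure : Measure DirLine :=
  (volume.restrict (Ici (0 : ℝ))).prod
    ((volume.restrict (Icc (-Real.pi) Real.pi)).prod ((1 / 2 : ℝ≥0∞) • (Measure.count : Measure Bool)))

/-- The geometric probability `Pr(X | G ∩ Ω ≠ ∅) = m(X, G ∩ Ω ≠ ∅) / m(G ∩ Ω ≠ ∅)` of an event `X`. -/
def lineProb (Ω : Set Plane) (X : Set DirLine) : ℝ≥0∞ :=
  lineMeasure ({G | (linePoints G ∩ Ω).Nonempty} ∩ X) /
    lineMeasure {G | (linePoints G ∩ Ω).Nonempty}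

/-! ### Networks -/

/-- A parametrized curve of finite length. -/
def Rectifiable (γ : I → Plane) : Prop := eVariationOn γ univ ≠ ∞

/-- The length of the curve `γ` from its start to the parameter `u`. -/
def arcLength (γ : I → Plane) (u : I) : ℝ := (eVariationOn γ (Iic u)).toReal

/-- A physical network between `s` and `t`: finitely many links, which are curves of finite length,
and finitely many routes, which are curves of finite length from `s` to `t`, each made up of
some of the links. -/
structure Network (s t : Plane) where
  numLinks : ℕ
  link : Fin numLinks → C(I, Plane)
  link_rectifiable : ∀ l, Rectifiable (link l)
  numRoutes : ℕ
  route : Fin numRoutes → Path s t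
  route_rectifiable : ∀ i, Rectifiable (route i)
  linksOf : Fin numRoutes → Set (Fin numLinks)
  range_route : ∀ i, range (route i) = ⋃ l ∈ linksOf i, range (link l)

/-- The network that consists of a single route `γ`. -/
def singleRoute {s t : Plane} (γ : Path s t) (hγ : Rectifiable γ) : Network s t where
  numLinks := 1
  link := fun _ => γ.toContinuousMap
  link_rectifiable := fun _ => hγ
  numRoutes := 1
  route := fun _ => γ
  route_rectifiable := fun _ => hγ
  linksOf := fun _ => univ
  range_route := by intro i; simp [Path.coe_toContinuousMap]; exact (iUnion_const _).symm

/-- The part of a link that a disaster can destroy when the link is divided, from its start on,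
alternately into protected parts of length `r * ε` and unprotected parts of length `(1 - r) * ε`. -/
def destroyable (r ε : ℝ) (γ : I → Plane) : Set Plane :=
  {x | ∃ u : I, γ u = x ∧ r ≤ Int.fract (arcLength γ u / ε)}

namespace Network

variable {s t : Plane} (N : Network s t)

/-- The points of the network. -/
def carrier : Set Plane := ⋃ l, range (N.link l)

/-- `s` and `t` stay connected under the disaster area `D`, for the division of the links with
parameters `r, ε`: there is a route none of whose links has a destroyed part. -/
def Connects (r ε : ℝ) (D : Set Plane) : Prop :=
  ∃ i, ∀ l ∈ N.linksOf i, destroyable r ε (N.link l) ∩ D = ∅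

/-- `Pr(s ↔ t)` for the division of the links with parameters `r, ε`, for the disaster area `R_G`
of a random directed line `G` that meets `Ω`. -/
def prConnect (Ω : Set Plane) (r ε : ℝ) : ℝ≥0∞ :=
  lineProb Ω {G | N.Connects r ε (rightHalfPlane G)}

/-- Under the weakest arrangement, `ε → 0`, with protected proportion `r`, one has `Pr(s ↔ t) = p`. -/
def WeakestPr (Ω : Set Plane) (r : ℝ) (p : ℝ≥0∞) : Prop :=
  Tendsto (fun ε : ℝ => N.prConnect Ω r ε) (𝓝[>] 0) (𝓝 p)

end Network

/-! ### Outer routes and inner parts -/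

/-- The point `p` lies between (is enclosed by) two curves `γ, γ'` with common ends: it is on neither
of them, and `γ` cannot be deformed into `γ'` with fixed ends without sweeping over `p` (that is,
the closed curve formed by `γ` and `γ'` winds around `p`). -/
def Between {s t : Plane} (p : Plane) (γ γ' : Path s t) : Prop :=
  p ∉ range γ ∧ p ∉ range γ' ∧ ∀ F : Path.Homotopy γ γ', ∃ z, F z = p

/-- The inner parts of the outer route `γ`, where `γ'` is the other outer route: the points of `γ`
that lie between `γ'` and `l(s, t)`. -/
def innerPart {s t : Plane} (γ γ' : Path s t) : Set Plane :=
  {p | p ∈ range γ ∧ Between p γ' (Path.segment s t)}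

/-- The routes `i` and `j` are the two outer routes of the network: they are distinct simple curves,
each of which meets every other route at `s` and `t` only, and the area enclosed by them
contains all the routes. -/
structure Network.IsOuterPair {s t : Plane} (N : Network s t) (i j : Fin N.numRoutes) : Prop where
  ne : i ≠ j
  simple_left : Function.Injective (N.route i)
  simple_right : Function.Injective (N.route j)
  disjoint_left : ∀ k, k ≠ i → range (N.route i) ∩ range (N.route k) ⊆ {s, t}
  disjoint_right : ∀ k, k ≠ j → range (N.route j) ∩ range (N.route k) ⊆ {s, t}
  enclosed : ∀ k, range (N.route k) ⊆
    range (N.route i) ∪ range (N.route j) ∪ {p | Between p (N.route i) (N.route j)}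

/-- The network with outer routes `i, j` is almost convex: `s` and `t` lie on the boundary of the
convex hull of the outer routes. -/
def Network.AlmostConvex {s t : Plane} (N : Network s t) (i j : Fin N.numRoutes) : Prop :=
  s ∈ frontier (convexHull ℝ (range (N.route i) ∪ range (N.route j))) ∧
    t ∈ frontier (convexHull ℝ (range (N.route i) ∪ range (N.route j)))

/-- The curve `γ` from `s` to `t` consists of the parts `P` and of line segments connecting them, `s`
and `t`: its point set is the union of `P` and of finitely many line segments whose ends are
`s`, `t` or end points of parts, and it runs through each point of the parts exactly once. -/
def ConsistsOfParts {s t : Plane} (γ : Path s t) (P : Set Plane) : Prop :=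
  (∃ A : Set (Plane × Plane), A.Finite ∧
    (∀ e ∈ A, e.1 ∈ (closure P \ P) ∪ {s, t} ∧ e.2 ∈ (closure P \ P) ∪ {s, t}) ∧
    range γ = P ∪ ⋃ e ∈ A, segment ℝ e.1 e.2) ∧
  ∀ p ∈ P, ∃! u, γ u = p

end

/-! Under the weakest arrangement an open half plane that meets a route also cuts it: for small ε a
piece of positive length inside the half plane contains unprotected points. So Pr(s ↔ t) is the
probability that the half plane misses some route (`weakestPr_lineProb`), and equality of the
probabilities reduces to geometry: a half plane misses some route iff it misses I₁ ∪ I₂ ∪ l(s,t)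
(`exists_route_avoids_iff`).

The geometry is done with angles. `logChange X p` is the increment of log (X - p) along X, and p
lies between two paths iff their increments differ (`between_iff`). Let K be the convex hull of the
outer routes. Since s and t are not interior to K, log (s - p) and log (t - p) have continuous
branches on K without s and t respectively. So the angle s p t has a preferred value, and the excess
of a path's increment over it is a multiple of 2πi, locally constant in K off the path. For two
paths that meet only at their ends, the excess of the first is a constant a on the second, that of
the second is a constant b on the first, and a + b is an odd multiple of 2πi (`logChange_pair`).

Hence a ≠ b. If a half plane missing s and t meets both outer routes, the single excess of l(s,t)
there cannot equal both a and b, so the half plane contains an inner point (`between_segment_or`). A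
route missing such a half plane would have the same excess from both outer routes; by the sum rule
both would then have the same excess on it, and it would not lie between them (`meets_of_enclosed`).
Conversely, a half plane that misses an outer route has a convex complement containing that route
and l(s,t), hence misses the inner part of the other.

The new route follows I₁ with l(s,t) filling the gaps, returns along l(s,t), and does the same with
I₂ (`exists_route_through_innerParts`). For the perimeters, nonempty inner parts lie strictly on
opposite sides of the line st (`innerPart_opposite`), and this line meets K in l(s,t) only. The hull
of everything is then two hulls glued along l(s,t), which bounds each of them but, apart from its
ends, not their union (`perimeter_convexHull_add`). -/

noncomputable section

/-! ### Complex logarithms along paths -/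

/-- The identification of the plane with the complex numbers. -/
def toC : Plane ≃ₗᵢ[ℝ] ℂ := Complex.orthonormalBasisOneI.repr.symm

lemma toC_sub_ne_zero {x y : Plane} : toC (x - y) ≠ 0 ↔ x ≠ y := by
  rw [Ne, map_eq_zero_iff _ toC.injective, sub_eq_zero]

/-- Homotopy lifting through the covering exp. The space `A` is arbitrary so that it can stand for
the viewpoints off a path, the chords between two paths, or the time of a homotopy. -/
lemma exists_log_lift {A : Type*} [TopologicalSpace A] (H : C(I × A, ℂ)) (hne : ∀ x, H x ≠ 0)
    (h0 : ∀ a, H (0, a) = 1) :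
    ∃ L : C(I × A, ℂ), (∀ x, Complex.exp (L x) = H x) ∧ ∀ a, L (0, a) = 0 := by
  let H' : C(I × A, {z : ℂ // z ≠ 0}) := ⟨fun x => ⟨H x, hne x⟩, by fun_prop⟩
  have hH0 : ∀ a, H' (0, a) =
      (fun z : ℂ ↦ (⟨_, z.exp_ne_zero⟩ : {z : ℂ // z ≠ 0})) ((0 : C(A, ℂ)) a) := by
    intro a
    ext
    simp [H', h0]
  refine ⟨Complex.isCoveringMap_exp.liftHomotopy H' 0 hH0, fun x => ?_, fun a => ?_⟩
  · have := congrFun (Complex.isCoveringMap_exp.liftHomotopy_lifts H' 0 hH0) x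
    exact congrArg Subtype.val this
  · exact Complex.isCoveringMap_exp.liftHomotopy_zero H' 0 hH0 a

/-- The fibres of exp are discrete. Every statement below that some angle is locally constant comes
from this. -/
lemma eq_of_exp_eq_const {A : Type*} [TopologicalSpace A] {S : Set A} (hS : IsPreconnected S)
    {g : A → ℂ} (hg : ContinuousOn g S) (c : ℂ) (hc : ∀ x ∈ S, Complex.exp (g x) = c)
    {x y : A} (hx : x ∈ S) (hy : y ∈ S) : g x = g y :=
  Complex.isCoveringMap_exp.constOn_of_comp hS hg
    (fun a ha a' ha' => Subtype.ext (by simp [hc a ha, hc a' ha'])) hx hy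

section

variable {s t : Plane}

/-- All viewpoints are lifted at once, which gives continuity in the viewpoint besides continuity in
the parameter. -/
lemma exists_log_along (X : Path s t) :
    ∃ L : I → Plane → ℂ, (∀ p ∉ range X, L 0 p = 0 ∧ Continuous (fun u => L u p) ∧
        ∀ u, Complex.exp (L u p) = toC (X u - p) / toC (s - p)) ∧
      ∀ u, ContinuousOn (L u) (range X)ᶜ := by
  have hs : ∀ a : ((range X)ᶜ : Set Plane), toC (s - a) ≠ 0 := fun a =>
    toC_sub_ne_zero.2 fun h => a.2 ⟨0, by simp [h]⟩
  have hX : ∀ (u : I) (a : ((range X)ᶜ : Set Plane)), toC (X u - a) ≠ 0 := fun u a =>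
    toC_sub_ne_zero.2 fun h => a.2 ⟨u, h⟩
  let H : C(I × ((range X)ᶜ : Set Plane), ℂ) :=
    ⟨fun x => toC (X x.1 - x.2) / toC (s - x.2), by
      refine Continuous.div₀ ?_ ?_ fun x => hs x.2
      · exact toC.continuous.comp (by fun_prop)
      · exact toC.continuous.comp (by fun_prop)⟩
  obtain ⟨L, hL, hL0⟩ := exists_log_lift H (fun x => div_ne_zero (hX _ _) (hs _))
    (fun a => by simp [H, -map_sub, hs a])
  classical
  refine ⟨fun u p => if h : p ∈ (range X)ᶜ then L (u, ⟨p, h⟩) else 0, fun p hp => ?_, fun u => ?_⟩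
  · have hp' : p ∈ (range X)ᶜ := hp
    simp only [hp', dif_pos]
    exact ⟨hL0 _, by fun_prop, fun u => hL _⟩
  · rw [continuousOn_iff_continuous_domRestrict]
    have : Continuous fun a : ((range X)ᶜ : Set Plane) => L (u, a) := by fun_prop
    convert this using 1
    funext a
    exact dif_pos a.2

/-- A continuous logarithm of `(X u - p) / (s - p)` that vanishes at the start of `X`. -/
def logAlong (X : Path s t) : I → Plane → ℂ := (exists_log_along X).choose

/-- The increment of the logarithm of `X - p` along the path `X`; its imaginary part is the angle
that `X` spans as seen from `p`. -/
def logChange (X : Path s t) (p : Plane) : ℂ := logAlong X 1 p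

variable {X Y : Path s t} {p : Plane}

lemma logAlong_zero (hp : p ∉ range X) : logAlong X 0 p = 0 :=
  ((exists_log_along X).choose_spec.1 p hp).1

lemma continuous_logAlong (hp : p ∉ range X) : Continuous fun u => logAlong X u p :=
  ((exists_log_along X).choose_spec.1 p hp).2.1

lemma exp_logAlong (hp : p ∉ range X) (u : I) :
    Complex.exp (logAlong X u p) = toC (X u - p) / toC (s - p) :=
  ((exists_log_along X).choose_spec.1 p hp).2.2 u

lemma exp_logChange (hp : p ∉ range X) :
    Complex.exp (logChange X p) = toC (t - p) / toC (s - p) := by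
  simpa [-map_sub, logChange] using exp_logAlong hp 1

lemma continuousOn_logChange (X : Path s t) : ContinuousOn (logChange X) (range X)ᶜ :=
  (exists_log_along X).choose_spec.2 1

lemma source_ne (hp : p ∉ range X) : s ≠ p := fun h => hp ⟨0, by simp [h]⟩

lemma target_ne (hp : p ∉ range X) : t ≠ p := fun h => hp ⟨1, by simp [h]⟩

/-- Every continuous logarithm along `X` computes `logChange`. -/
lemma logChange_eq (hp : p ∉ range X) {l : I → ℂ} (hl : Continuous l) (c : ℂ)
    (h : ∀ u, Complex.exp (l u) = c * toC (X u - p)) : logChange X p = l 1 - l 0 := by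
  have hs : toC (s - p) ≠ 0 := toC_sub_ne_zero.2 (source_ne hp)
  have := eq_of_exp_eq_const isPreconnected_univ
    (g := fun u => l u - logAlong X u p)
    ((hl.sub (continuous_logAlong hp)).continuousOn) (c * toC (s - p))
    (fun u _ => by
      have hX : toC (X u - p) ≠ 0 := toC_sub_ne_zero.2 fun h => hp ⟨u, h⟩
      rw [Complex.exp_sub, h, exp_logAlong hp]
      field_simp) (mem_univ (1 : I)) (mem_univ 0)
  simp only [logAlong_zero hp, sub_zero] at this
  rw [logChange, ← this]
  ring

/-! ### Points between two paths -/

/-- A logarithm lifts over the whole homotopy square, and the fixed ends of the homotopy keep its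
value at the end of the paths constant in time. -/
lemma logChange_eq_of_homotopy (F : Path.Homotopy X Y) (hF : ∀ z, F z ≠ p) :
    logChange X p = logChange Y p := by
  have hX : p ∉ range X := by
    rintro ⟨u, rfl⟩
    exact hF (0, u) (by simp)
  have hY : p ∉ range Y := by
    rintro ⟨u, rfl⟩
    exact hF (1, u) (by simp)
  have hs : toC (s - p) ≠ 0 := toC_sub_ne_zero.2 (source_ne hX)
  let H : C(I × I, ℂ) := ⟨fun x => toC (F (x.2, x.1) - p) / toC (s - p), by
    refine Continuous.div_const ?_ _
    exact toC.continuous.comp (by fun_prop)⟩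
  obtain ⟨L, hL, hL0⟩ := exists_log_lift H
    (fun x => div_ne_zero (toC_sub_ne_zero.2 (hF _)) hs) (fun a => by simp [H, -map_sub, hs])
  have h1 := eq_of_exp_eq_const isPreconnected_univ (g := fun a : I => L (1, a)) (by fun_prop)
    (toC (t - p) / toC (s - p)) (fun a _ => by simp [hL, H]) (mem_univ 0) (mem_univ 1)
  rw [logChange_eq hX (l := fun u => L (u, 0)) (by fun_prop) (toC (s - p))⁻¹
      (fun u => by simp [hL, H]; ring),
    logChange_eq hY (l := fun u => L (u, 1)) (by fun_prop) (toC (s - p))⁻¹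
      (fun u => by simp [hL, H]; ring)]
  rw [h1, hL0, hL0]

/-- Interpolate linearly between the two logarithms and exponentiate: the result never hits `p`, and
equal increments keep the end `t` fixed. -/
lemma exists_homotopy_of_logChange_eq (hX : p ∉ range X) (hY : p ∉ range Y)
    (h : logChange X p = logChange Y p) : ∃ F : Path.Homotopy X Y, ∀ z, F z ≠ p := by
  have hs : toC (s - p) ≠ 0 := toC_sub_ne_zero.2 (source_ne hX)
  let g : I × I → ℂ := fun z =>
    (1 - (z.1 : ℝ) : ℂ) * logAlong X z.2 p + ((z.1 : ℝ) : ℂ) * logAlong Y z.2 p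
  have hg : Continuous g := by
    have h1 := (continuous_logAlong hX).comp (continuous_snd (X := I) (Y := I))
    have h2 := (continuous_logAlong hY).comp (continuous_snd (X := I) (Y := I))
    have h3 : Continuous fun z : I × I => ((z.1 : ℝ) : ℂ) :=
      Complex.continuous_ofReal.comp (continuous_subtype_val.comp continuous_fst)
    exact ((continuous_const.sub h3).mul h1).add (h3.mul h2)
  let F : I × I → Plane := fun z => p + toC.symm (toC (s - p) * Complex.exp (g z))
  have hF : Continuous F := continuous_const.add
    (toC.symm.continuous.comp (continuous_const.mul (Complex.continuous_exp.comp hg)))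
  have key : ∀ {Z : Path s t} (_ : p ∉ range Z) (u : I) (w : ℂ), w = logAlong Z u p →
      p + toC.symm (toC (s - p) * Complex.exp w) = Z u := by
    rintro Z hZ u w rfl
    rw [exp_logAlong hZ, mul_div_cancel₀ _ hs]
    simp
  have e0 : ∀ u, F (0, u) = X u := fun u => key hX u _ (by simp [g])
  have e1 : ∀ u, F (1, u) = Y u := fun u => key hY u _ (by simp [g])
  refine ⟨⟨⟨⟨F, hF⟩, fun u => e0 u, fun u => e1 u⟩, ?_⟩, ?_⟩
  · rintro τ u (rfl | hu)
    · exact key hX 0 _ (by simp [g, logAlong_zero hX, logAlong_zero hY])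
    · rw [mem_singleton_iff] at hu
      subst hu
      refine key hX 1 _ ?_
      have h' : logAlong X 1 p = logAlong Y 1 p := h
      simp only [g, ← h']
      ring
  · intro z hz
    have hz' : p + toC.symm (toC (s - p) * Complex.exp (g z)) = p := hz
    rw [add_eq_left, map_eq_zero_iff _ toC.symm.injective] at hz'
    exact mul_ne_zero hs (Complex.exp_ne_zero _) hz'

lemma between_iff : Between p X Y ↔ p ∉ range X ∧ p ∉ range Y ∧ logChange X p ≠ logChange Y p := by
  refine and_congr_right fun hX => and_congr_right fun hY => ⟨fun h he => ?_, fun h F => ?_⟩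
  · obtain ⟨F, hF⟩ := exists_homotopy_of_logChange_eq hX hY he
    obtain ⟨z, hz⟩ := h F
    exact hF z hz
  · by_contra! hF
    exact h (logChange_eq_of_homotopy F hF)

/-- The straight-line homotopy stays inside `C`. -/
lemma not_between_of_convex {C : Set Plane} (hC : Convex ℝ C) (hX : range X ⊆ C)
    (hY : range Y ⊆ C) (hp : p ∉ C) : ¬ Between p X Y := by
  rintro ⟨-, -, h⟩
  have hcont : Continuous fun z : I × I => (1 - (z.1 : ℝ)) • X z.2 + (z.1 : ℝ) • Y z.2 := by
    fun_prop
  obtain ⟨z, hz⟩ := h ⟨⟨⟨_, hcont⟩, fun u => by simp, fun u => by simp⟩, by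
    rintro τ u (rfl | hu)
    · simp [← add_smul]
    · rw [mem_singleton_iff] at hu
      simp [hu, ← add_smul]⟩
  apply hp
  rw [← hz]
  exact hC (hX ⟨_, rfl⟩) (hY ⟨_, rfl⟩) (sub_nonneg.2 z.1.2.2) z.1.2.1 (by ring)

lemma logChange_eq_of_convex {C : Set Plane} (hC : Convex ℝ C) (hX : range X ⊆ C)
    (hY : range Y ⊆ C) (hp : p ∉ C) : logChange X p = logChange Y p := by
  by_contra h
  exact not_between_of_convex hC hX hY hp
    (between_iff.2 ⟨fun h => hp (hX h), fun h => hp (hY h), h⟩)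

lemma exp_logChange_sub (hX : p ∉ range X) (hY : p ∉ range Y) :
    Complex.exp (logChange X p - logChange Y p) = 1 := by
  rw [Complex.exp_sub, exp_logChange hX, exp_logChange hY, div_self]
  exact div_ne_zero (toC_sub_ne_zero.2 (target_ne hX)) (toC_sub_ne_zero.2 (source_ne hX))

/-- Off the two paths, the difference of the angles spanned by them is locally constant. -/
lemma logChange_sub_const {S : Set Plane} (hS : IsPreconnected S) (hX : Disjoint S (range X))
    (hY : Disjoint S (range Y)) {x y : Plane} (hx : x ∈ S) (hy : y ∈ S) :
    logChange X x - logChange Y x = logChange X y - logChange Y y :=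
  eq_of_exp_eq_const hS (((continuousOn_logChange X).mono hX.subset_compl_right).sub
      ((continuousOn_logChange Y).mono hY.subset_compl_right)) 1
    (fun _ hz => exp_logChange_sub (disjoint_left.1 hX hz) (disjoint_left.1 hY hz)) hx hy

end

/-! ### Two paths with common ends on the boundary of a convex set -/

/-- `l` is a continuous logarithm of `s - p` for `p` in `K \ {s}`. -/
def IsBranchLog (K : Set Plane) (s : Plane) (l : Plane → ℂ) : Prop :=
  ContinuousOn l (K \ {s}) ∧ ∀ p ∈ K \ {s}, Complex.exp (l p) = toC (s - p)

lemma exists_support {K : Set Plane} (hK : Convex ℝ K) (hne : (interior K).Nonempty) {s : Plane}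
    (hs : s ∉ interior K) :
    ∃ F : Plane →L[ℝ] ℝ, (∀ p ∈ K, F p ≤ F s) ∧ ∀ p ∈ interior K, F p < F s := by
  obtain ⟨F, hF⟩ := geometric_hahn_banach_open_point hK.interior isOpen_interior hs
  refine ⟨F, fun p hp => ?_, hF⟩
  have h1 : p ∈ closure (interior K) := by
    rw [hK.closure_interior_eq_closure_of_nonempty_interior hne]
    exact subset_closure hp
  exact closure_minimal (fun x hx => (hF x hx).le) (isClosed_le F.continuous continuous_const) h1

/-- A supporting line at `s` keeps all directions `s - p` in a closed half plane; turned to the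
right half plane without 0, they lie in the domain of the principal logarithm. -/
lemma exists_isBranchLog {K : Set Plane} (hK : Convex ℝ K) (hne : (interior K).Nonempty) {s : Plane}
    (hs : s ∉ interior K) : ∃ l, IsBranchLog K s l := by
  obtain ⟨F, hF, hF'⟩ := exists_support hK hne hs
  -- The complex number representing `F`, in the sense that `F x` is the real part of `toC x * n`.
  let n : ℂ := ⟨F (toC.symm 1), -F (toC.symm Complex.I)⟩
  have hFn : ∀ x, (toC x * n).re = F x := by
    intro x
    have hx : x = (toC x).re • toC.symm 1 + (toC x).im • toC.symm Complex.I := by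
      rw [← map_smul, ← map_smul, ← map_add, LinearIsometryEquiv.eq_symm_apply]
      apply Complex.ext <;> simp
    conv_rhs => rw [hx]
    simp [n, Complex.mul_re]
  have hn : n ≠ 0 := by
    intro hn
    obtain ⟨x, hx⟩ := hne
    have := hF' x hx
    rw [← hFn, ← hFn, hn] at this
    simp at this
  have hslit : ∀ p ∈ K \ {s}, toC (s - p) * n ∈ Complex.slitPlane := by
    intro p hp
    have h0 : 0 ≤ (toC (s - p) * n).re := by
      rw [hFn, map_sub, sub_nonneg]
      exact hF p hp.1
    rw [Complex.mem_slitPlane_iff]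
    by_contra! h
    have hz : toC (s - p) * n = 0 := Complex.ext (le_antisymm h.1 h0) h.2
    exact mul_ne_zero (toC_sub_ne_zero.2 fun e => hp.2 e.symm) hn hz
  refine ⟨fun p => Complex.log (toC (s - p) * n) - Complex.log n, ?_, fun p hp => ?_⟩
  · refine ContinuousOn.sub (ContinuousOn.clog ?_ hslit) continuousOn_const
    exact ((toC.continuous.comp (continuous_const.sub continuous_id)).mul
      continuous_const).continuousOn
  · rw [Complex.exp_sub, Complex.exp_log hn, Complex.exp_log (Complex.slitPlane_ne_zero (hslit p hp)),
      mul_div_cancel_right₀ _ hn]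

section

variable {s t : Plane} {K : Set Plane} {lS lT : Plane → ℂ} {X Y : Path s t}

/-- The paths `X` and `Y` meet at their common ends only, and pass through these only once. -/
def MeetAtEnds (X Y : Path s t) : Prop :=
  ∀ u v, X u = Y v → (u = 0 ∧ v = 0) ∨ (u = 1 ∧ v = 1)

lemma MeetAtEnds.symm (h : MeetAtEnds X Y) : MeetAtEnds Y X := fun u v e =>
  (h v u e.symm).imp And.symm And.symm

lemma MeetAtEnds.notMem (h : MeetAtEnds X Y) {v : I} (h0 : v ≠ 0) (h1 : v ≠ 1) :
    Y v ∉ range X := by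
  rintro ⟨u, hu⟩
  rcases h u v hu with h | h
  · exact h0 h.2
  · exact h1 h.2

lemma MeetAtEnds.eq_zero (h : MeetAtEnds X Y) {u : I} (hu : X u = s) : u = 0 := by
  rcases h u 0 (by simp [hu]) with h | h
  · exact h.1
  · exact absurd h.2 zero_ne_one

lemma MeetAtEnds.eq_one (h : MeetAtEnds X Y) {u : I} (hu : X u = t) : u = 1 := by
  rcases h u 1 (by simp [hu]) with h | h
  · exact absurd h.2 one_ne_zero
  · exact h.1

lemma isPreconnected_ne_one : IsPreconnected {v : I | v ≠ 1} := by
  have : {v : I | v ≠ 1} = Iio 1 := by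
    ext v
    exact (unitInterval.lt_one_iff_ne_one).symm
  rw [this]
  exact isPreconnected_Iio

lemma isPreconnected_ne_zero : IsPreconnected {v : I | v ≠ 0} := by
  have : {v : I | v ≠ 0} = Ioi 0 := by
    ext v
    exact (unitInterval.pos_iff_ne_zero).symm
  rw [this]
  exact isPreconnected_Ioi

lemma IsBranchLog.comp {x : Plane} {l : Plane → ℂ} (h : IsBranchLog K x l) (hX : range X ⊆ K)
    {U : Set I} (hU : ∀ u ∈ U, X u ≠ x) : ContinuousOn (fun u => l (X u)) U :=
  h.1.comp X.continuous.continuousOn fun u hu => ⟨hX ⟨u, rfl⟩, hU u hu⟩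

/-- A continuous logarithm of the chords from one path to the other. -/
lemma exists_log_chord (hst : s ≠ t) (hXY : MeetAtEnds X Y) :
    ∃ G : I × I → ℂ, ContinuousOn G {w | w ≠ (0, 0) ∧ w ≠ (1, 1)} ∧
      ∀ u v, (u, v) ≠ ((0, 0) : I × I) → (u, v) ≠ ((1, 1) : I × I) →
        Complex.exp (G (u, v)) = toC (X u - Y v) / toC (t - s) := by
  have hts : toC (t - s) ≠ 0 := toC_sub_ne_zero.2 hst.symm
  let A : Set (I × I) := {w | w ≠ (0, 0) ∧ w ≠ (1, 1)}
  -- The square without the corners (0,0) and (1,1) is star-shaped about the corner (1,0), whose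
  -- chord is t - s. Contracting to it with factor τ reaches a removed corner only from that corner
  -- itself.
  have hne : ∀ x : I × A,
      X (unitInterval.symm (x.1 * unitInterval.symm x.2.1.1)) ≠ Y (x.1 * x.2.1.2) := by
    rintro ⟨τ, ⟨⟨u, v⟩, h0, h1⟩⟩ he
    have hτ : ∀ x y : I, (x : ℝ) * y = 1 → x = 1 ∧ y = 1 := by
      intro x y h
      have := x.2.1; have := x.2.2; have := y.2.1; have := y.2.2
      constructor <;> ext <;> simp only [Icc.coe_one] <;> nlinarith
    rcases hXY _ _ he with ⟨h2, h3⟩ | ⟨h2, h3⟩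
    · have h4 := congrArg Subtype.val h2
      simp only [unitInterval.coe_symm_eq, Icc.coe_mul, Icc.coe_zero] at h4
      obtain ⟨rfl, h5⟩ := hτ τ (unitInterval.symm u) (by
        simp only [unitInterval.coe_symm_eq]; linarith)
      apply h0
      have h6 : u = 0 := by
        rw [← unitInterval.symm_symm u, h5, unitInterval.symm_one]
      simp only [one_mul] at h3
      rw [h6, h3]
    · have h4 := congrArg Subtype.val h3
      simp only [Icc.coe_mul, Icc.coe_one] at h4
      obtain ⟨rfl, h5⟩ := hτ τ v h4
      apply h1
      simp only [one_mul, unitInterval.symm_symm] at h2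
      rw [h5, h2]
  let H : C(I × A, ℂ) := ⟨fun x =>
      toC (X (unitInterval.symm (x.1 * unitInterval.symm x.2.1.1)) - Y (x.1 * x.2.1.2)) /
        toC (t - s), by
    refine Continuous.div_const ?_ _
    exact toC.continuous.comp (by fun_prop)⟩
  obtain ⟨L, hL, hL0⟩ := exists_log_lift H
    (fun x => div_ne_zero (toC_sub_ne_zero.2 (hne x)) hts)
    (fun a => by simp [H, -map_sub, hts])
  classical
  refine ⟨fun w => if h : w ∈ A then L (1, ⟨w, h⟩) else 0, ?_, fun u v h0 h1 => ?_⟩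
  · rw [continuousOn_iff_continuous_domRestrict]
    have : Continuous fun a : A => L (1, a) := by fun_prop
    convert this using 1
    funext a
    exact dif_pos a.2
  · have h : ((u, v) : I × I) ∈ A := ⟨h0, h1⟩
    simp only [h, dif_pos]
    simp [hL, H, -map_sub]

/-- Seen from the points of the one path, the other path spans the angle `s p t` up to a constant
multiple of the full angle, and the two constants add up to an odd number. -/
lemma logChange_pair (hst : s ≠ t) (hS : IsBranchLog K s lS) (hT : IsBranchLog K t lT)
    (hX : range X ⊆ K) (hY : range Y ⊆ K) (hXY : MeetAtEnds X Y) :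
    ∃ a b : ℂ, a + b = 2 * (lS t - lT s) ∧
      (∀ p ∈ range Y, p ≠ s → p ≠ t → logChange X p = lT p - lS p + a) ∧
      ∀ p ∈ range X, p ≠ s → p ≠ t → logChange Y p = lT p - lS p + b := by
  have hts : toC (t - s) ≠ 0 := toC_sub_ne_zero.2 hst.symm
  obtain ⟨G, hGc, hG⟩ := exists_log_chord hst hXY
  have hXs : ∀ u, u ≠ 0 → X u ≠ s := fun u hu h => hu (hXY.eq_zero h)
  have hXt : ∀ u, u ≠ 1 → X u ≠ t := fun u hu h => hu (hXY.eq_one h)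
  have hYs : ∀ u, u ≠ 0 → Y u ≠ s := fun u hu h => hu (hXY.symm.eq_zero h)
  have hYt : ∀ u, u ≠ 1 → Y u ≠ t := fun u hu h => hu (hXY.symm.eq_one h)
  have exp_ratio : ∀ x y p q : Plane, p ≠ q → x - y = p - q →
      toC (x - y) / toC (t - s) / toC (p - q) = 1 / toC (t - s) := by
    intro x y p q hpq h
    have := toC_sub_ne_zero.2 hpq
    rw [h]
    field_simp
  have exp_ratio' : ∀ x y p q : Plane, p ≠ q → x - y = q - p →
      toC (x - y) / toC (t - s) / toC (p - q) = -1 / toC (t - s) := by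
    intro x y p q hpq h
    have := toC_sub_ne_zero.2 hpq
    rw [h, ← neg_sub p q, map_neg]
    field_simp
  -- On each side of the square one end of the chord is s or t, so `G` differs from a branch
  -- logarithm by a constant, read off at the corner (1,0) or (0,1). On `top` and `bot` the chord
  -- points the other way, whence the -1.
  have right : ∀ v, v ≠ 1 → G (1, v) - lT (Y v) = G (1, 0) - lT s := by
    intro v hv
    have := eq_of_exp_eq_const isPreconnected_ne_one
      (g := fun v => G (1, v) - lT (Y v))
      ((hGc.comp (by fun_prop) fun v hv => by simpa using hv).sub (hT.comp hY fun v hv => hYt v hv))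
      (1 / toC (t - s)) (fun v hv => by
        rw [Complex.exp_sub, hG _ _ (by simp) (by simpa using hv), hT.2 _ ⟨hY ⟨v, rfl⟩, hYt v hv⟩]
        exact exp_ratio _ _ _ _ (hYt v hv).symm (by simp)) hv (zero_ne_one (α := I))
    simpa using this
  have left : ∀ v, v ≠ 0 → G (0, v) - lS (Y v) = G (0, 1) - lS t := by
    intro v hv
    have := eq_of_exp_eq_const isPreconnected_ne_zero
      (g := fun v => G (0, v) - lS (Y v))
      ((hGc.comp (by fun_prop) fun v hv => by simpa using hv).sub (hS.comp hY fun v hv => hYs v hv))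
      (1 / toC (t - s)) (fun v hv => by
        rw [Complex.exp_sub, hG _ _ (by simpa using hv) (by simp), hS.2 _ ⟨hY ⟨v, rfl⟩, hYs v hv⟩]
        exact exp_ratio _ _ _ _ (hYs v hv).symm (by simp)) hv (one_ne_zero (α := I))
    simpa using this
  have top : ∀ u, u ≠ 1 → G (u, 1) - lT (X u) = G (0, 1) - lT s := by
    intro u hu
    have := eq_of_exp_eq_const isPreconnected_ne_one
      (g := fun u => G (u, 1) - lT (X u))
      ((hGc.comp (by fun_prop) fun v hv => by simpa using hv).sub (hT.comp hX fun v hv => hXt v hv))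
      (-1 / toC (t - s)) (fun v hv => by
        rw [Complex.exp_sub, hG _ _ (by simp) (by simpa using hv), hT.2 _ ⟨hX ⟨v, rfl⟩, hXt v hv⟩]
        exact exp_ratio' _ _ _ _ (hXt v hv).symm (by simp)) hu (zero_ne_one (α := I))
    simpa using this
  have bot : ∀ u, u ≠ 0 → G (u, 0) - lS (X u) = G (1, 0) - lS t := by
    intro u hu
    have := eq_of_exp_eq_const isPreconnected_ne_zero
      (g := fun u => G (u, 0) - lS (X u))
      ((hGc.comp (by fun_prop) fun v hv => by simpa using hv).sub (hS.comp hX fun v hv => hXs v hv))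
      (-1 / toC (t - s)) (fun v hv => by
        rw [Complex.exp_sub, hG _ _ (by simpa using hv) (by simp), hS.2 _ ⟨hX ⟨v, rfl⟩, hXs v hv⟩]
        exact exp_ratio' _ _ _ _ (hXs v hv).symm (by simp)) hu (one_ne_zero (α := I))
    simpa using this
  -- The increment of X seen from Y v is G(1,v) - G(0,v), that of Y seen from X u is G(u,1) -
  -- G(u,0). In the sum of the constants all values of `G` cancel.
  refine ⟨G (1, 0) - lT s - (G (0, 1) - lS t), G (0, 1) - lT s - (G (1, 0) - lS t), by ring, ?_, ?_⟩
  · rintro _ ⟨v, rfl⟩ hs ht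
    have hv0 : v ≠ 0 := fun h => hs (by simp [h])
    have hv1 : v ≠ 1 := fun h => ht (by simp [h])
    rw [logChange_eq (hXY.notMem hv0 hv1) (l := fun u => G (u, v))
      (hGc.comp_continuous (by fun_prop) fun u => by simp [hv0, hv1]) (toC (t - s))⁻¹
      (fun u => by rw [hG _ _ (by simp [hv0]) (by simp [hv1])]; ring)]
    linear_combination right v hv1 - left v hv0
  · rintro _ ⟨u, rfl⟩ hs ht
    have hu0 : u ≠ 0 := fun h => hs (by simp [h])
    have hu1 : u ≠ 1 := fun h => ht (by simp [h])
    rw [logChange_eq (hXY.symm.notMem hu0 hu1) (l := fun v => G (u, v))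
      (hGc.comp_continuous (by fun_prop) fun u => by simp [hu0, hu1]) (-(toC (t - s))⁻¹)
      (fun v => by
        rw [hG _ _ (by simp [hu0]) (by simp [hu1]), ← neg_sub (Y v), map_neg]; ring)]
    linear_combination top u hu1 - bot u hu0

/-- The angle of a path as seen from `p`, relative to the angle `s p t`, is locally constant. -/
lemma logChange_branch_const (hS : IsBranchLog K s lS) (hT : IsBranchLog K t lT)
    {W : Set Plane} (hW : IsPreconnected W) (hWK : W ⊆ K) (hX : Disjoint W (range X))
    {x y : Plane} (hx : x ∈ W) (hy : y ∈ W) :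
    logChange X x - (lT x - lS x) = logChange X y - (lT y - lS y) := by
  have h1 : W ⊆ K \ {s} := fun p hp => ⟨hWK hp, (source_ne (disjoint_left.1 hX hp)).symm⟩
  have h2 : W ⊆ K \ {t} := fun p hp => ⟨hWK hp, (target_ne (disjoint_left.1 hX hp)).symm⟩
  refine eq_of_exp_eq_const hW (((continuousOn_logChange X).mono hX.subset_compl_right).sub
      ((hT.1.mono h2).sub (hS.1.mono h1))) 1 (fun p hp => ?_) hx hy
  simp only [Pi.sub_apply]
  rw [Complex.exp_sub, Complex.exp_sub, exp_logChange (disjoint_left.1 hX hp), hT.2 p (h2 hp),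
    hS.2 p (h1 hp), div_self]
  exact div_ne_zero (toC_sub_ne_zero.2 (target_ne (disjoint_left.1 hX hp)))
    (toC_sub_ne_zero.2 (source_ne (disjoint_left.1 hX hp)))

end

/-! ### Sides of a line -/

/-- The linear form whose level through `s` is the line through `s` and `t`. -/
def side (s t : Plane) : Plane →L[ℝ] ℝ :=
  (t 0 - s 0) • EuclideanSpace.proj (1 : Fin 2) - (t 1 - s 1) • EuclideanSpace.proj (0 : Fin 2)

lemma side_apply (s t z : Plane) :
    side s t z = (t 0 - s 0) * z 1 - (t 1 - s 1) * z 0 := rfl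

lemma side_right (s t : Plane) : side s t t = side s t s := by
  simp only [side_apply]
  ring

lemma plane_ext {x y : Plane} (h0 : x 0 = y 0) (h1 : x 1 = y 1) : x = y := by
  ext i
  fin_cases i
  · exact h0
  · exact h1

lemma eq_on_segment {s t z : Plane} {f : Plane →L[ℝ] ℝ} (h : f s = f t) (hz : z ∈ segment ℝ s t) :
    f z = f s := by
  obtain ⟨a, b, -, -, hab, rfl⟩ := hz
  simp only [map_add, map_smul, smul_eq_mul, ← h]
  rw [← add_mul, hab, one_mul]

/-- The points s, t, x are affinely independent, so they span the plane; the coefficients in `key`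
are those of Cramer's rule. -/
lemma interior_nonempty_of_side_ne {C : Set Plane} (hC : Convex ℝ C) {s t x : Plane} (hs : s ∈ C)
    (ht : t ∈ C) (hx : x ∈ C) (h : side s t x ≠ side s t s) : (interior C).Nonempty := by
  rw [hC.interior_nonempty_iff_affineSpan_eq_top, eq_top_iff]
  intro z _
  have hD : side s t x - side s t s ≠ 0 := sub_ne_zero.2 h
  have mem : ∀ w ∈ C, w ∈ affineSpan ℝ C := fun w hw => subset_affineSpan ℝ C hw
  have key := AffineSubspace.smul_vsub_vadd_mem (affineSpan ℝ C)
    ((side s t z - side s t s) / (side s t x - side s t s)) (mem x hx) (mem s hs)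
    (AffineSubspace.smul_vsub_vadd_mem (affineSpan ℝ C)
      ((side x s z - side x s s) / (side s t x - side s t s)) (mem t ht) (mem s hs) (mem s hs))
  convert key using 1
  have hD' : side s t x - side s t s = (t 0 - s 0) * x 1 - (t 1 - s 1) * x 0 -
      ((t 0 - s 0) * s 1 - (t 1 - s 1) * s 0) := rfl
  generalize side s t x - side s t s = D at hD hD'
  apply plane_ext <;> simp [side_apply] <;> field_simp <;> rw [hD'] <;> ring

/-- A point of a chord of a convex set that has points on both sides of the chord is interior. -/
lemma mem_interior_of_openSegment {C : Set Plane} (hC : Convex ℝ C) {s t a b p q x : Plane}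
    (ha : a ∈ C) (hb : b ∈ C) (hab : a ≠ b) (hsa : side s t a = side s t s)
    (hsb : side s t b = side s t s) (hst : s ≠ t) (hp : p ∈ C) (hq : q ∈ C)
    (hps : side s t s < side s t p)
    (hqs : side s t q < side s t s) (hx : x ∈ openSegment ℝ a b) : x ∈ interior C := by
  obtain ⟨α, β, hα, hβ, hαβ, hx⟩ := hx
  have hd : t 0 - s 0 ≠ 0 ∨ t 1 - s 1 ≠ 0 := by
    by_contra! h
    exact hst (plane_ext (by linarith) (by linarith))
  have hne : (interior C).Nonempty := by
    refine interior_nonempty_of_side_ne hC ha hb hp fun h => ?_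
    obtain ⟨μ, h0, h1⟩ : ∃ μ : ℝ, b 0 - a 0 = μ * (t 0 - s 0) ∧ b 1 - a 1 = μ * (t 1 - s 1) := by
      simp only [side_apply] at hsa hsb
      rcases hd with hd | hd
      · refine ⟨(b 0 - a 0) / (t 0 - s 0), by field_simp, ?_⟩
        field_simp
        linear_combination hsb - hsa
      · refine ⟨(b 1 - a 1) / (t 1 - s 1), ?_, by field_simp⟩
        field_simp
        linear_combination hsa - hsb
    have hμ : μ ≠ 0 := by
      rintro rfl
      exact hab (plane_ext (by linarith) (by linarith))
    have h2 : μ * (side s t p - side s t a) = 0 := by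
      simp only [side_apply, h0, h1] at h ⊢
      linear_combination h
    have := mul_eq_zero.1 h2
    rcases this with h | h
    · exact hμ h
    · linarith
  by_contra hxi
  obtain ⟨F, hF, hF'⟩ := exists_support hC hne hxi
  have hFx : F x = α * F a + β * F b := by simp [← hx]
  have hFa : F a = F x ∧ F b = F x := by
    have h1 := hF a ha
    have h2 := hF b hb
    have e : α * (F x - F a) + β * (F x - F b) = 0 := by linear_combination F x * hαβ + hFx
    have e1 := mul_nonneg hα.le (sub_nonneg.2 h1)
    have e2 := mul_nonneg hβ.le (sub_nonneg.2 h2)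
    have e3 : α * (F x - F a) = 0 := by linarith
    have e4 : β * (F x - F b) = 0 := by linarith
    exact ⟨by linarith [(mul_eq_zero.1 e3).resolve_left hα.ne'],
      by linarith [(mul_eq_zero.1 e4).resolve_left hβ.ne']⟩
  have hsx : side s t x = side s t s := by
    simp only [← hx, map_add, map_smul, smul_eq_mul, hsa, hsb]
    rw [← add_mul, hαβ, one_mul]
  have hF2 : ∀ z, F z = z 0 * F (EuclideanSpace.single 0 1) + z 1 * F (EuclideanSpace.single 1 1) := by
    intro z
    conv_lhs => rw [show z = z 0 • EuclideanSpace.single 0 1 + z 1 • EuclideanSpace.single 1 1 from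
      plane_ext (by simp) (by simp)]
    simp only [map_add, map_smul, smul_eq_mul]
  -- The supporting form is constant along the chord, which is parallel to st, so it is a multiple
  -- of `side` up to a constant. Points on both sides then force c = 0, against strictness on the
  -- interior.
  have hlam : ∃ c : ℝ, ∀ z, F z - F x = c * (side s t z - side s t x) := by
    have h3 : (b 0 - a 0) * F (EuclideanSpace.single 0 1) +
        (b 1 - a 1) * F (EuclideanSpace.single 1 1) = 0 := by
      have := hFa.1.trans hFa.2.symm
      rw [hF2 a, hF2 b] at this
      linarith
    have hd' : b 0 - a 0 ≠ 0 ∨ b 1 - a 1 ≠ 0 := by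
      by_contra! h
      exact hab (plane_ext (by linarith) (by linarith))
    have h4 : (t 0 - s 0) * F (EuclideanSpace.single 0 1) +
        (t 1 - s 1) * F (EuclideanSpace.single 1 1) = 0 := by
      simp only [side_apply] at hsa hsb
      rcases hd' with h | h
      · apply mul_left_cancel₀ h
        linear_combination (t 0 - s 0) * h3 + F (EuclideanSpace.single 1 1) * (hsa - hsb)
      · apply mul_left_cancel₀ h
        linear_combination (t 1 - s 1) * h3 + F (EuclideanSpace.single 0 1) * (hsb - hsa)
    rcases hd with h | h
    · refine ⟨F (EuclideanSpace.single 1 1) / (t 0 - s 0), fun z => ?_⟩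
      simp only [side_apply, hF2 z, hF2 x]
      field_simp
      linear_combination (z 0 - x 0) * h4
    · refine ⟨-F (EuclideanSpace.single 0 1) / (t 1 - s 1), fun z => ?_⟩
      simp only [side_apply, hF2 z, hF2 x]
      field_simp
      linear_combination (z 1 - x 1) * h4
  obtain ⟨c, hc⟩ := hlam
  have h5 := hc p
  have h6 := hc q
  have h7 := hF p hp
  have h8 := hF q hq
  have hc0 : c = 0 := by
    apply le_antisymm <;> nlinarith
  obtain ⟨z, hz⟩ := hne
  have := hc z
  rw [hc0, zero_mul] at this
  linarith [hF' z hz]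

/-! ### Paths that enclose each other -/

section

variable {s t : Plane} {K R : Set Plane} {lS lT : Plane → ℂ} {X Y Z : Path s t} {p q : Plane}

/-- A route need not be simple; it is cut down to the piece from its last visit to s until the next
visit to t. -/
lemma exists_subpath (hst : s ≠ t) (Z : Path s t) :
    ∃ Z' : Path s t, range Z' ⊆ range Z ∧ (∀ u, Z' u = s → u = 0) ∧ ∀ u, Z' u = t → u = 1 := by
  obtain ⟨a, ha, ha'⟩ : ∃ a, IsGreatest {u | Z u = s} a :=
    (isClosed_eq Z.continuous continuous_const).isCompact.exists_isGreatest ⟨0, by simp⟩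
  obtain ⟨b, ⟨hab, hb⟩, hb'⟩ : ∃ b, IsLeast {u | a ≤ u ∧ Z u = t} b :=
    (isClosed_Ici.inter (isClosed_eq Z.continuous continuous_const)).isCompact.exists_isLeast
      ⟨1, unitInterval.le_one', by simp⟩
  have hne : (a : ℝ) ≠ b := fun h => hst (ha.symm.trans ((congrArg Z (Subtype.ext h)).trans hb))
  refine ⟨(Z.subpath a b).cast ha.symm hb.symm, ?_, fun u hu => ?_, fun u hu => ?_⟩
  · rintro _ ⟨u, rfl⟩
    exact ⟨_, rfl⟩
  · have h1 : (Icc.convexComb a b u : ℝ) ≤ a := ha' hu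
    have h2 := Icc.coe_convexComb a b u
    have h3 : (a : ℝ) < b := lt_of_le_of_ne hab hne
    have h4 := u.2.1
    ext
    simp only [Icc.coe_zero]
    nlinarith
  · have h1 : (b : ℝ) ≤ Icc.convexComb a b u := hb' ⟨Icc.le_convexComb hab u, hu⟩
    have h2 := Icc.coe_convexComb a b u
    have h3 : (a : ℝ) < b := lt_of_le_of_ne hab hne
    have h4 := u.2.2
    ext
    simp only [Icc.coe_one]
    nlinarith

/-- This is the parity: lS t - lT s is an odd multiple of πi, because s - t and t - s differ by a
sign. -/
lemma exp_branch_sub (hst : s ≠ t) (hs : s ∈ K) (ht : t ∈ K) (hS : IsBranchLog K s lS)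
    (hT : IsBranchLog K t lT) : Complex.exp (lS t - lT s) = -1 := by
  have h := toC_sub_ne_zero.2 hst.symm
  rw [Complex.exp_sub, hS.2 t ⟨ht, hst.symm⟩, hT.2 s ⟨hs, hst⟩, ← neg_sub t s, map_neg, neg_div,
    div_self h]

/-- If a half plane meets two paths, then some point of the one path in the half plane lies between
the other path and the segment. -/
lemma between_segment_or (hst : s ≠ t) (hK : Convex ℝ K) (hS : IsBranchLog K s lS)
    (hT : IsBranchLog K t lT) (hX : range X ⊆ K) (hY : range Y ⊆ K) (hXY : MeetAtEnds X Y)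
    (hR : Convex ℝ R) (hR' : Convex ℝ Rᶜ) (hs : s ∉ R) (ht : t ∉ R) (hp : p ∈ range X) (hpR : p ∈ R)
    (hq : q ∈ range Y) (hqR : q ∈ R) :
    Between p Y (Path.segment s t) ∨ Between q X (Path.segment s t) := by
  obtain ⟨a, b, hab, ha, hb⟩ := logChange_pair hst hS hT hX hY hXY
  have hps : p ≠ s := fun h => hs (h ▸ hpR)
  have hpt : p ≠ t := fun h => ht (h ▸ hpR)
  have hqs : q ≠ s := fun h => hs (h ▸ hqR)
  have hqt : q ≠ t := fun h => ht (h ▸ hqR)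
  have hseg : range (Path.segment s t) ⊆ Rᶜ := by
    rw [Path.range_segment]
    exact hR'.segment_subset hs ht
  have hpY : p ∉ range Y := by
    obtain ⟨u, rfl⟩ := hp
    exact hXY.symm.notMem (fun h => hps (by simp [h])) (fun h => hpt (by simp [h]))
  have hqX : q ∉ range X := by
    obtain ⟨u, rfl⟩ := hq
    exact hXY.notMem (fun h => hqs (by simp [h])) (fun h => hqt (by simp [h]))
  simp only [between_iff]
  by_contra! h
  have h1 := h.1 hpY fun h => hseg h hpR
  have h2 := h.2 hqX fun h => hseg h hqR
  have h3 := logChange_branch_const hS hT (W := R ∩ K) (X := Path.segment s t)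
    (hR.inter hK).isPreconnected inter_subset_right
    (disjoint_left.2 fun x hx hx' => hseg hx' hx.1) ⟨hpR, hX hp⟩ ⟨hqR, hY hq⟩
  rw [← h1, ← h2, hb p hp hps hpt, ha q hq hqs hqt] at h3
  -- With neither point between, a = b is half of 2 (lS t - lT s), so exp a = -1; but a is the
  -- excess of a path, so exp a = 1.
  have h4 : a = lS t - lT s := by linear_combination (hab - h3) / 2
  have h5 := exp_branch_sub hst (hX ⟨0, by simp⟩) (hX ⟨1, by simp⟩) hS hT
  have h6 : Complex.exp (logChange X q - (lT q - lS q)) = 1 := by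
    rw [Complex.exp_sub, Complex.exp_sub, exp_logChange hqX, hT.2 q ⟨hY hq, hqt⟩,
      hS.2 q ⟨hY hq, hqs⟩, div_self]
    exact div_ne_zero (toC_sub_ne_zero.2 hqt.symm) (toC_sub_ne_zero.2 hqs.symm)
  rw [ha q hq hqs hqt, add_sub_cancel_left, h4, h5] at h6
  norm_num at h6

/-- If a half plane meets two paths, then it meets every path between them. -/
lemma meets_of_enclosed (hst : s ≠ t) (hK : Convex ℝ K) (hS : IsBranchLog K s lS)
    (hT : IsBranchLog K t lT) (hX : range X ⊆ K) (hY : range Y ⊆ K)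
    (hXinj : Function.Injective X) (hYinj : Function.Injective Y)
    (hXZ : range X ∩ range Z ⊆ {s, t}) (hYZ : range Y ∩ range Z ⊆ {s, t})
    (hZ : range Z ⊆ range X ∪ range Y ∪ {p | Between p X Y})
    (hR : Convex ℝ R) (hs : s ∉ R) (ht : t ∉ R) (hp : p ∈ range X) (hpR : p ∈ R)
    (hq : q ∈ range Y) (hqR : q ∈ R) : ∃ z ∈ range Z, z ∈ R := by
  by_contra! hZR
  obtain ⟨W, hWZ, hW0, hW1⟩ := exists_subpath hst Z
  have hmeet : ∀ V : Path s t, Function.Injective V → range V ∩ range Z ⊆ {s, t} →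
      MeetAtEnds V W := by
    intro V hV hVZ u v huv
    rcases hVZ ⟨⟨u, rfl⟩, hWZ ⟨v, huv.symm⟩⟩ with h | h
    · exact Or.inl ⟨hV (by simpa using h), hW0 v (huv ▸ h)⟩
    · rw [mem_singleton_iff] at h
      exact Or.inr ⟨hV (by simpa using h), hW1 v (huv ▸ h)⟩
  have hWK : range W ⊆ K := by
    intro z hz
    rcases hZ (hWZ hz) with (h | h) | h
    · exact hX h
    · exact hY h
    · by_contra hzK
      exact not_between_of_convex hK hX hY hzK h
  have hXW := hmeet X hXinj hXZ
  have hYW := hmeet Y hYinj hYZ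
  obtain ⟨a, b, hab, ha, hb⟩ := logChange_pair hst hS hT hX hWK hXW
  obtain ⟨a', b', hab', ha', hb'⟩ := logChange_pair hst hS hT hY hWK hYW
  have h3 := logChange_branch_const hS hT (W := R ∩ K) (X := W)
    (hR.inter hK).isPreconnected inter_subset_right
    (disjoint_left.2 fun x hx hx' => hZR x (hWZ hx') hx.1) ⟨hpR, hX hp⟩ ⟨hqR, hY hq⟩
  rw [hb p hp (fun h => hs (h ▸ hpR)) (fun h => ht (h ▸ hpR)),
    hb' q hq (fun h => hs (h ▸ hqR)) (fun h => ht (h ▸ hqR))] at h3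
  -- X and Y both have the sum rule with W, with the same right-hand side, and `h3` says b = b'.
  have haa : a = a' := by linear_combination hab - hab' - h3
  obtain ⟨v, hv0, hv1⟩ : ∃ v : I, v ≠ 0 ∧ v ≠ 1 :=
    ⟨⟨1 / 2, by norm_num, by norm_num⟩, fun h => by
      have := congrArg Subtype.val h
      norm_num at this, fun h => by
      have := congrArg Subtype.val h
      norm_num at this⟩
  have hWs : W v ≠ s := fun h => hv0 (hW0 v h)
  have hWt : W v ≠ t := fun h => hv1 (hW1 v h)
  rcases hZ (hWZ ⟨v, rfl⟩) with (h | h) | h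
  · exact hXW.notMem hv0 hv1 h
  · exact hYW.notMem hv0 hv1 h
  · apply (between_iff.1 h).2.2
    rw [ha _ ⟨v, rfl⟩ hWs hWt, ha' _ ⟨v, rfl⟩ hWs hWt, haa]

/-- If e is on X, then `K \ {e}` is still convex and contains Y and l(s,t), so both have the same
angle seen from e. The excess of Y is constant on X, and that of the segment is constant along pe,
so the equality carries over to p. If e is on Y, the same holds for q. -/
lemma not_both_between_of_extreme (hst : s ≠ t) (hK : Convex ℝ K) (hS : IsBranchLog K s lS)
    (hT : IsBranchLog K t lT) (hX : range X ⊆ K) (hY : range Y ⊆ K) (hXY : MeetAtEnds X Y)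
    {e : Plane} (he : e ∈ K.extremePoints ℝ) (heXY : e ∈ range X ∪ range Y)
    (hp : p ∈ range X) (hpe : segment ℝ p e ⊆ K \ segment ℝ s t)
    (hq : q ∈ range Y) (hqe : segment ℝ q e ⊆ K \ segment ℝ s t)
    (hpY : Between p Y (Path.segment s t)) (hqX : Between q X (Path.segment s t)) : False := by
  obtain ⟨a, b, hab, ha, hb⟩ := logChange_pair hst hS hT hX hY hXY
  rw [between_iff] at hpY hqX
  have hsK : s ∈ K := hX ⟨0, by simp⟩
  have htK : t ∈ K := hX ⟨1, by simp⟩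
  have hes : e ≠ s := fun h => (hpe (right_mem_segment ℝ p e)).2 (h ▸ left_mem_segment ℝ s t)
  have het : e ≠ t := fun h => (hpe (right_mem_segment ℝ p e)).2 (h ▸ right_mem_segment ℝ s t)
  have hconst : ∀ z, segment ℝ z e ⊆ K \ segment ℝ s t →
      logChange (Path.segment s t) z - (lT z - lS z) =
        logChange (Path.segment s t) e - (lT e - lS e) := fun z hz =>
    logChange_branch_const hS hT (convex_segment z e).isPreconnected
      (fun x hx => (hz hx).1) (disjoint_left.2 fun x hx hx' =>
        (hz hx).2 (by rwa [Path.range_segment] at hx')) (left_mem_segment ℝ z e)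
        (right_mem_segment ℝ z e)
  have hp1 := hconst p hpe
  have hq1 := hconst q hqe
  have hdiff : Convex ℝ (K \ {e}) := (hK.mem_extremePoints_iff_convex_sdiff.1 he).2
  have hsub : ∀ V : Path s t, range V ⊆ K → e ∉ range V →
      logChange V e = logChange (Path.segment s t) e := fun V hV heV =>
    logChange_eq_of_convex hdiff (fun x hx => ⟨hV hx, fun h => heV (h ▸ hx)⟩)
      (by rw [Path.range_segment]
          exact hdiff.segment_subset ⟨hsK, hes.symm⟩ ⟨htK, het.symm⟩) (fun h => h.2 rfl)
  rcases heXY with heX | heY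
  · have heY : e ∉ range Y := by
      obtain ⟨u, rfl⟩ := heX
      exact hXY.symm.notMem (fun h => hes (by simp [h])) (fun h => het (by simp [h]))
    apply hpY.2.2
    have h1 := hsub Y hY heY
    rw [hb e heX hes het] at h1
    rw [hb p hp (source_ne hpY.1).symm (target_ne hpY.1).symm]
    linear_combination h1 - hp1
  · have heX : e ∉ range X := by
      obtain ⟨u, rfl⟩ := heY
      exact hXY.notMem (fun h => hes (by simp [h])) (fun h => het (by simp [h]))
    apply hqX.2.2
    have h1 := hsub X hX heX
    rw [ha e heY hes het] at h1
    rw [ha q hq (source_ne hqX.1).symm (target_ne hqX.1).symm]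
    linear_combination h1 - hq1

end

/-! ### Compactness of convex hulls -/

lemma sum_eq_sum_comp_embedding {α β M : Type*} [Fintype α] [Fintype β] [AddCommMonoid M]
    (e : α ↪ β) {g : β → M} (hg : ∀ i ∉ range e, g i = 0) : ∑ i, g i = ∑ j, g (e j) := by
  rw [← Finset.sum_map Finset.univ e g]
  refine (Finset.sum_subset (Finset.subset_univ _) fun i _ hi => hg i ?_).symm
  simpa using hi

/-- The convex hull of a compact set in finite dimension is compact. -/
lemma isCompact_convexHull_of_isCompact {E : Type*} [NormedAddCommGroup E] [NormedSpace ℝ E]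
    [FiniteDimensional ℝ E] {A : Set E} (hA : IsCompact A) : IsCompact (convexHull ℝ A) := by
  -- Carathéodory's bound. Shorter combinations are padded with weight 0 and arbitrary points of
  -- `A`.
  let n := Module.finrank ℝ E + 1
  let φ : (Fin n → ℝ) × (Fin n → E) → E := fun w => ∑ i, w.1 i • w.2 i
  have hφ : Continuous φ := by fun_prop
  have himg : convexHull ℝ A = φ '' (stdSimplex ℝ (Fin n) ×ˢ Set.pi univ fun _ => A) := by
    apply Subset.antisymm
    · intro x hx
      obtain ⟨ι, _, z, w, hz, hind, hw, hw1, rfl⟩ := eq_pos_convex_span_of_mem_convexHull hx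
      have hcard : Fintype.card ι ≤ Fintype.card (Fin n) := by
        rw [Fintype.card_fin]
        exact hind.card_le_finrank_succ.trans (Nat.succ_le_succ (Submodule.finrank_le _))
      obtain ⟨e⟩ := Function.Embedding.nonempty_of_card_le hcard
      have : Nonempty ι := by
        by_contra h
        rw [not_nonempty_iff] at h
        simp at hw1
      have hsum := fun (g : Fin n → ℝ) hg => sum_eq_sum_comp_embedding e (g := g) hg
      have hsum' := fun (g : Fin n → E) hg => sum_eq_sum_comp_embedding e (g := g) hg
      have hext0 : ∀ i ∉ range e, Function.extend e w (0 : Fin n → ℝ) i = 0 := fun i hi =>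
        Function.extend_apply' w (0 : Fin n → ℝ) i hi
      refine ⟨(Function.extend e w (0 : Fin n → ℝ), z ∘ Function.invFun e), ⟨⟨fun i => ?_, ?_⟩, ?_⟩, ?_⟩
      · change 0 ≤ Function.extend e w (0 : Fin n → ℝ) i
        by_cases hi : i ∈ range e
        · obtain ⟨j, rfl⟩ := hi
          rw [e.injective.extend_apply]
          exact (hw j).le
        · rw [hext0 i hi]
      · change ∑ i, Function.extend e w (0 : Fin n → ℝ) i = 1
        rw [hsum _ hext0, ← hw1]
        exact Finset.sum_congr rfl fun j _ => e.injective.extend_apply _ _ _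
      · exact fun i _ => hz ⟨_, rfl⟩
      · change ∑ i, Function.extend e w (0 : Fin n → ℝ) i • z (Function.invFun e i) = _
        rw [hsum' _ fun i hi => by rw [hext0 i hi, zero_smul]]
        refine Finset.sum_congr rfl fun j _ => ?_
        rw [e.injective.extend_apply, Function.leftInverse_invFun e.injective]
    · rintro _ ⟨⟨w, z⟩, ⟨hw, hz⟩, rfl⟩
      exact (convex_convexHull ℝ A).sum_mem (fun i _ => hw.1 i) hw.2
        fun i _ => subset_convexHull ℝ A (hz i (mem_univ i))
  rw [himg]
  exact ((isCompact_stdSimplex ℝ _).prod (isCompact_univ_pi fun _ => hA)).image hφ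

/-! ### Inner parts lie on opposite sides -/

lemma exists_smul_of_side_eq {s t z : Plane} (hst : s ≠ t) (h : side s t z = side s t s) :
    ∃ μ : ℝ, z = s + μ • (t - s) := by
  have hd : t 0 - s 0 ≠ 0 ∨ t 1 - s 1 ≠ 0 := by
    by_contra! h
    exact hst (plane_ext (by linarith) (by linarith))
  simp only [side_apply] at h
  rcases hd with hd | hd
  · refine ⟨(z 0 - s 0) / (t 0 - s 0), plane_ext ?_ ?_⟩ <;> simp <;> field_simp
    · ring
    · linear_combination h
  · refine ⟨(z 1 - s 1) / (t 1 - s 1), plane_ext ?_ ?_⟩ <;> simp <;> field_simp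
    · linear_combination -h
    · ring

/-- A point of K on the line beyond s would put s inside a chord with points of K on both sides,
hence into the interior; likewise for t. -/
lemma mem_segment_of_side_eq {K : Set Plane} (hK : Convex ℝ K) {s t p q z : Plane} (hst : s ≠ t)
    (hs : s ∈ K) (ht : t ∈ K) (hsi : s ∉ interior K) (hti : t ∉ interior K) (hp : p ∈ K)
    (hq : q ∈ K) (hps : side s t s < side s t p) (hqs : side s t q < side s t s) (hz : z ∈ K)
    (hzs : side s t z = side s t s) : z ∈ segment ℝ s t := by
  obtain ⟨μ, rfl⟩ := exists_smul_of_side_eq hst hzs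
  rcases lt_or_ge μ 0 with h0 | h0
  · refine absurd (mem_interior_of_openSegment hK hz ht ?_ hzs (side_right s t) hst hp hq hps hqs
      (x := s) ?_) hsi
    · intro h
      have : (μ - 1) • (t - s) = 0 := by rw [sub_smul, one_smul, ← sub_eq_zero.2 h]; abel
      rcases smul_eq_zero.1 this with h | h
      · linarith
      · exact hst (sub_eq_zero.1 h).symm
    · refine ⟨1 / (1 - μ), -μ / (1 - μ), by apply div_pos <;> linarith,
        by apply div_pos <;> linarith, ?_, ?_⟩
      · have : (1 - μ) ≠ 0 := by linarith
        field_simp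
        ring
      · have : (1 - μ) ≠ 0 := by linarith
        apply plane_ext <;> simp <;> field_simp <;> ring
  rcases le_or_gt μ 1 with h1 | h1
  · exact ⟨1 - μ, μ, by linarith, h0, by ring, by module⟩
  · refine absurd (mem_interior_of_openSegment hK hs hz ?_ rfl hzs hst hp hq hps hqs
      (x := t) ?_) hti
    · intro h
      rcases smul_eq_zero.1 (left_eq_add.1 h) with h | h
      · linarith
      · exact hst (sub_eq_zero.1 h).symm
    · refine ⟨1 - 1 / μ, 1 / μ, ?_, by positivity, by ring, ?_⟩
      · have : 1 / μ < 1 := by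
          rw [div_lt_one] <;> linarith
        linarith
      · have : μ ≠ 0 := by linarith
        apply plane_ext <;> simp <;> field_simp <;> ring

section

variable {s t : Plane} {X Y : Path s t} {p q : Plane}

lemma exists_mem_segment_eq {f : Plane →L[ℝ] ℝ} {c : ℝ} {x y : Plane} (hx : c ≤ f x) (hy : f y ≤ c) :
    ∃ z ∈ segment ℝ x y, f z = c :=
  (convex_segment x y).isPreconnected.intermediate_value (right_mem_segment ℝ x y)
    (left_mem_segment ℝ x y) f.continuous.continuousOn ⟨hy, hx⟩

/-- Two paths within the line st would both pass through the midpoint of s and t. -/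
lemma exists_side_ne (hst : s ≠ t) (hXY : MeetAtEnds X Y) :
    ∃ x ∈ range X ∪ range Y, side s t x ≠ side s t s := by
  by_contra! h
  have hmid : ∀ V : Path s t, range V ⊆ range X ∪ range Y →
      ∃ u, V u = s + (1 / 2 : ℝ) • (t - s) := by
    intro V hV
    have hnorm : 0 < inner ℝ (t - s) (t - s) := real_inner_self_pos.2 (sub_ne_zero.2 hst.symm)
    obtain ⟨u, -, hu⟩ := (isPreconnected_univ (α := I)).intermediate_value (mem_univ 0) (mem_univ 1)
      (f := fun u => inner ℝ (V u - s) (t - s)) (by fun_prop)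
      (show (1 / 2 : ℝ) * inner ℝ (t - s) (t - s) ∈ _ by
        constructor <;> simp only [Path.source, Path.target, sub_self, inner_zero_left] <;> linarith)
    obtain ⟨μ, hμ⟩ := exists_smul_of_side_eq hst (h (V u) (hV ⟨u, rfl⟩))
    refine ⟨u, ?_⟩
    simp only [hμ, add_sub_cancel_left, inner_smul_left, conj_trivial] at hu
    rw [hμ, mul_right_cancel₀ hnorm.ne' hu]
  obtain ⟨u, hu⟩ := hmid X subset_union_left
  obtain ⟨v, hv⟩ := hmid Y subset_union_right
  have hts : t - s ≠ 0 := sub_ne_zero.2 hst.symm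
  rcases hXY u v (hu.trans hv.symm) with ⟨rfl, -⟩ | ⟨rfl, -⟩
  · rw [X.source, left_eq_add] at hu
    simp [hts] at hu
  · rw [X.target, ← sub_eq_iff_eq_add', ← sub_eq_zero] at hu
    have : (1 / 2 : ℝ) • (t - s) = 0 := by
      rw [← hu]
      module
    simp [hts] at this

lemma subset_hull_left : range X ⊆ convexHull ℝ (range X ∪ range Y) :=
  subset_union_left.trans (subset_convexHull ℝ _)

lemma subset_hull_right : range Y ⊆ convexHull ℝ (range X ∪ range Y) :=
  subset_union_right.trans (subset_convexHull ℝ _)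

lemma isCompact_hull : IsCompact (convexHull ℝ (range X ∪ range Y)) :=
  isCompact_convexHull_of_isCompact
    ((isCompact_range X.continuous).union (isCompact_range Y.continuous))

lemma exists_branchLogs (hst : s ≠ t) (hXY : MeetAtEnds X Y)
    (hs : s ∉ interior (convexHull ℝ (range X ∪ range Y)))
    (ht : t ∉ interior (convexHull ℝ (range X ∪ range Y))) :
    ∃ lS lT, IsBranchLog (convexHull ℝ (range X ∪ range Y)) s lS ∧
      IsBranchLog (convexHull ℝ (range X ∪ range Y)) t lT := by
  obtain ⟨x, hx, hne⟩ := exists_side_ne hst hXY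
  have hK := convex_convexHull ℝ (range X ∪ range Y)
  have hi := interior_nonempty_of_side_ne hK (subset_hull_left ⟨0, X.source⟩)
    (subset_hull_left ⟨1, X.target⟩) (subset_convexHull ℝ _ hx) hne
  obtain ⟨lS, hS⟩ := exists_isBranchLog hK hi hs
  obtain ⟨lT, hT⟩ := exists_isBranchLog hK hi ht
  exact ⟨lS, lT, hS, hT⟩

/-- An extreme point e of K strictly above the level of s and t can be joined to p and q by segments
that miss l(s,t), so the extreme point argument applies. -/
lemma not_both_between_of_le (hst : s ≠ t) (hXY : MeetAtEnds X Y)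
    (hs : s ∉ interior (convexHull ℝ (range X ∪ range Y)))
    (ht : t ∉ interior (convexHull ℝ (range X ∪ range Y)))
    {f : Plane →L[ℝ] ℝ} (hf : f s = f t)
    {x : Plane} (hx : x ∈ range X ∪ range Y) (hfx : f s < f x)
    (hp : p ∈ innerPart X Y) (hq : q ∈ innerPart Y X) (hfp : f s ≤ f p) (hfq : f s ≤ f q) :
    False := by
  obtain ⟨lS, lT, hS, hT⟩ := exists_branchLogs hst hXY hs ht
  set K := convexHull ℝ (range X ∪ range Y) with hKdef
  have hK : Convex ℝ K := convex_convexHull ℝ _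
  have hcomp : IsCompact K := isCompact_hull
  have hexp : IsExposed ℝ K (f.toExposed K) := ContinuousLinearMap.toExposed.isExposed
  obtain ⟨m, hmK, hm⟩ := hcomp.exists_isMaxOn ⟨s, subset_hull_left ⟨0, X.source⟩⟩
    f.continuous.continuousOn
  -- Taken in the face where f is maximal; being extreme in K as well, e lies on one of the two
  -- paths.
  obtain ⟨e, he⟩ := (hexp.isCompact hcomp).extremePoints_nonempty ⟨m, hmK, hm⟩
  have heK : e ∈ K.extremePoints ℝ := hexp.isExtreme.extremePoints_subset_extremePoints he
  have hfe : f s < f e := hfx.trans_le (he.1.2 x (subset_convexHull ℝ _ hx))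
  have hseg : ∀ z ∈ K, z ∉ segment ℝ s t → f s ≤ f z → segment ℝ z e ⊆ K \ segment ℝ s t := by
    intro z hz hzs hfz w hw
    refine ⟨hK.segment_subset hz he.1.1 hw, fun hws => ?_⟩
    have h1 := eq_on_segment hf hws
    obtain ⟨a, b, ha, hb, hab, rfl⟩ := hw
    simp only [map_add, map_smul, smul_eq_mul] at h1
    have hb0 : b = 0 := by
      by_contra hb0
      have hb' : 0 < b := lt_of_le_of_ne hb (Ne.symm hb0)
      have e1 : a * (f z - f s) + b * (f e - f s) = 0 := by linear_combination h1 - f s * hab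
      have e2 := mul_nonneg ha (sub_nonneg.2 hfz)
      have e3 := mul_pos hb' (sub_pos.2 hfe)
      linarith
    subst hb0
    rw [add_zero] at hab
    subst hab
    exact hzs (by simpa using hws)
  have hp' : p ∉ segment ℝ s t := by
    have := hp.2.2.1
    rwa [Path.range_segment] at this
  have hq' : q ∉ segment ℝ s t := by
    have := hq.2.2.1
    rwa [Path.range_segment] at this
  exact not_both_between_of_extreme hst hK hS hT subset_hull_left subset_hull_right hXY heK
    (extremePoints_convexHull_subset heK) hp.1 (hseg p (subset_hull_left hp.1) hp' hfp)
    hq.1 (hseg q (subset_hull_right hq.1) hq' hfq) hp.2 hq.2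

/-- Points of the two inner parts lie strictly on opposite sides of the line through `s`, `t`. -/
lemma innerPart_opposite (hst : s ≠ t) (hXY : MeetAtEnds X Y)
    (hs : s ∉ interior (convexHull ℝ (range X ∪ range Y)))
    (ht : t ∉ interior (convexHull ℝ (range X ∪ range Y)))
    (hp : p ∈ innerPart X Y) (hq : q ∈ innerPart Y X) :
    (side s t s < side s t p ∧ side s t q < side s t s) ∨
      (side s t p < side s t s ∧ side s t s < side s t q) := by
  obtain ⟨x, hx, hne⟩ := exists_side_ne hst hXY
  have pos : ∀ y ∈ range X ∪ range Y, side s t s < side s t y → side s t s ≤ side s t p →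
      side s t s ≤ side s t q → False := fun y hy h h1 h2 =>
    not_both_between_of_le hst hXY hs ht (side_right s t).symm hy h hp hq h1 h2
  have neg : ∀ y ∈ range X ∪ range Y, side s t y < side s t s → side s t p ≤ side s t s →
      side s t q ≤ side s t s → False := fun y hy h h1 h2 =>
    not_both_between_of_le hst hXY hs ht (f := -side s t) (by simp [side_right]) hy
      (by simpa using h) hp hq (by simpa using h1) (by simpa using h2)
  have hpX : p ∈ range X ∪ range Y := Or.inl hp.1
  have hqX : q ∈ range X ∪ range Y := Or.inr hq.1
  rcases lt_trichotomy (side s t p) (side s t s) with h1 | h1 | h1 <;>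
  rcases lt_trichotomy (side s t q) (side s t s) with h2 | h2 | h2
  · exact (neg p hpX h1 h1.le h2.le).elim
  · exact (neg p hpX h1 h1.le h2.le).elim
  · exact Or.inr ⟨h1, h2⟩
  · exact (neg q hqX h2 h1.le h2.le).elim
  · rcases lt_or_gt_of_ne hne with h | h
    · exact (neg x hx h h1.le h2.le).elim
    · exact (pos x hx h h1.ge h2.ge).elim
  · exact (pos q hqX h2 h1.ge h2.le).elim
  · exact Or.inl ⟨h1, h2⟩
  · exact (pos p hpX h1 h1.le h2.ge).elim
  · exact (pos p hpX h1 h1.le h2.le).elim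

end

/-! ### Perimeters of convex sets cut by a line -/

section

variable {s t : Plane} {K P Q : Set Plane}

lemma side_surjective (hst : s ≠ t) : Function.Surjective (side s t) := by
  have hd : t 0 - s 0 ≠ 0 ∨ t 1 - s 1 ≠ 0 := by
    by_contra! h
    exact hst (plane_ext (by linarith) (by linarith))
  intro y
  rcases hd with hd | hd
  · refine ⟨!₂[0, y / (t 0 - s 0)], ?_⟩
    simp only [side_apply]
    simp
    field_simp
  · refine ⟨!₂[-y / (t 1 - s 1), 0], ?_⟩
    simp only [side_apply]
    simp
    field_simp

lemma side_lt_of_mem_interior (hst : s ≠ t) {C : Set Plane} {c : ℝ}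
    (hC : ∀ x ∈ C, c ≤ side s t x) {x : Plane} (hx : x ∈ interior C) : c < side s t x := by
  have hopen := (side s t).isOpenMap (side_surjective hst) _ (isOpen_interior (s := C))
  have hsub : side s t '' interior C ⊆ interior (Ici c) := by
    refine interior_maximal ?_ hopen
    rintro _ ⟨y, hy, rfl⟩
    exact hC y (interior_subset hy)
  rw [interior_Ici] at hsub
  exact hsub ⟨x, hx, rfl⟩

lemma perimeter_segment (hst : s ≠ t) :
    perimeter (segment ℝ s t) = 2 * μH[1] (segment ℝ s t) := by
  rw [perimeter, if_neg]
  rintro ⟨x, hx⟩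
  have h1 := side_lt_of_mem_interior hst (C := segment ℝ s t) (c := side s t s)
    (fun x hx => (eq_on_segment (side_right s t).symm hx).ge) hx
  exact h1.ne' (eq_on_segment (side_right s t).symm (interior_subset hx))

/-- A segment from C to D crosses the level line at a point that belongs to both sets. -/
lemma convex_union_of_sides {C D : Set Plane} (hC : Convex ℝ C) (hD : Convex ℝ D)
    {f : Plane →L[ℝ] ℝ} {c : ℝ} (hK : Convex ℝ K) (hCK : C ⊆ K) (hDK : D ⊆ K)
    (hfC : ∀ x ∈ C, c ≤ f x) (hfD : ∀ x ∈ D, f x ≤ c)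
    (hline : ∀ z ∈ K, f z = c → z ∈ C ∩ D) : Convex ℝ (C ∪ D) := by
  have key : ∀ x ∈ C, ∀ y ∈ D, segment ℝ x y ⊆ C ∪ D := by
    intro x hx y hy w hw
    have hwxy := mem_segment_iff_wbtw.1 hw
    rcases le_total c (f w) with h | h
    · obtain ⟨z, hz, hfz⟩ := exists_mem_segment_eq h (hfD y hy)
      have hzxy := mem_segment_iff_wbtw.1 hz
      have hwz := mem_segment_iff_wbtw.2 (hwxy.trans_right_left hzxy)
      have hzK := hK.segment_subset (hK.segment_subset (hCK hx) (hDK hy) hw) (hDK hy) hz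
      exact Or.inl (hC.segment_subset hx (hline z hzK hfz).1 hwz)
    · obtain ⟨z, hz, hfz⟩ := exists_mem_segment_eq (hfC x hx) h
      have hzxy := mem_segment_iff_wbtw.1 hz
      have hwz := mem_segment_iff_wbtw.2 (hwxy.trans_left_right hzxy)
      have hzK := hK.segment_subset (hCK hx) (hK.segment_subset (hCK hx) (hDK hy) hw) hz
      exact Or.inr (hD.segment_subset (hline z hzK hfz).2 hy hwz)
  rw [convex_iff_segment_subset]
  rintro x (hx | hx) y (hy | hy)
  · exact (hC.segment_subset hx hy).trans subset_union_left
  · exact key x hx y hy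
  · rw [segment_symm]
    exact key y hy x hx
  · exact (hD.segment_subset hx hy).trans subset_union_right

lemma measure_split {α : Type*} [MeasurableSpace α] (μ : Measure α) {f : α → ℝ} (hf : Measurable f)
    (c : ℝ) (F : Set α) :
    μ F = μ (F ∩ {x | c < f x}) + μ (F ∩ {x | f x < c}) + μ (F ∩ {x | f x = c}) := by
  have h1 : MeasurableSet {x | c < f x} := measurableSet_lt measurable_const hf
  have h2 : MeasurableSet {x | f x < c} := measurableSet_lt hf measurable_const
  rw [← measure_inter_add_sdiff F h1, ← measure_inter_add_sdiff (F \ {x | c < f x}) h2, add_assoc]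
  congr 3
  · ext x
    exact ⟨fun h => ⟨h.1.1, h.2⟩, fun h => ⟨⟨h.1, fun h3 : c < f x => lt_asymm h3 h.2⟩, h.2⟩⟩
  · ext x
    exact ⟨fun h => ⟨h.1.1, le_antisymm (not_lt.1 h.1.2) (not_lt.1 h.2)⟩,
      fun h => ⟨⟨h.1, not_lt.2 (le_of_eq h.2)⟩, not_lt.2 (ge_of_eq h.2)⟩⟩

lemma frontier_inter_congr {C D O : Set Plane} (hO : IsOpen O) (h : C ∩ O = D ∩ O) :
    frontier C ∩ O = frontier D ∩ O := by
  rw [← frontier_inter_open_inter hO, h, frontier_inter_open_inter hO]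

/-- The part of the boundary of a convex set on the line through `s`, `t`, when the set lies on
one side of the line and meets it in the segment. -/
lemma frontier_inter_line {ε : ℝ} (hε : ε = 1 ∨ ε = -1) (hst : s ≠ t) {C : Set Plane}
    (hKc : IsClosed K) (hCK : C ⊆ K) (hseg : segment ℝ s t ⊆ C)
    (hC : ∀ x ∈ C, ε * side s t s ≤ ε * side s t x)
    (hline : ∀ z ∈ K, side s t z = side s t s → z ∈ segment ℝ s t) :
    frontier C ∩ {x | side s t x = side s t s} = segment ℝ s t := by
  ext z
  constructor
  · rintro ⟨hz, hzs⟩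
    exact hline z (closure_minimal hCK hKc hz.1) hzs
  · intro hz
    have hzs := eq_on_segment (side_right s t).symm hz
    refine ⟨⟨subset_closure (hseg hz), fun hi => ?_⟩, hzs⟩
    rcases hε with rfl | rfl
    · exact (side_lt_of_mem_interior hst (fun x hx => by simpa using hC x hx) hi).ne' hzs
    · have h1 : ∀ w, side t s w = - side s t w := fun w => by simp only [side_apply]; ring
      have := side_lt_of_mem_interior hst.symm (c := - side s t s)
        (fun x hx => by rw [h1]; simpa using hC x hx) hi
      rw [h1, hzs] at this
      exact lt_irrefl _ this

/-- Cutting a convex set along a chord adds twice the length of the chord to the perimeter. -/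
lemma perimeter_convexHull_add (hst : s ≠ t) (hK : Convex ℝ K) (hKc : IsClosed K)
    (hPK : P ⊆ K) (hQK : Q ⊆ K) (hs : s ∈ K) (ht : t ∈ K)
    (hP : ∀ p ∈ P, side s t s < side s t p) (hQ : ∀ q ∈ Q, side s t q < side s t s)
    (hPne : P.Nonempty) (hQne : Q.Nonempty)
    (hline : ∀ z ∈ K, side s t z = side s t s → z ∈ segment ℝ s t) :
    perimeter (convexHull ℝ (P ∪ segment ℝ s t)) + perimeter (convexHull ℝ (Q ∪ segment ℝ s t)) =
      perimeter (convexHull ℝ (P ∪ Q ∪ segment ℝ s t)) + perimeter (segment ℝ s t) := by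
  have hsegK : segment ℝ s t ⊆ K := hK.segment_subset hs ht
  have hside := fun z hz => eq_on_segment (z := z) (side_right s t).symm hz
  set C := convexHull ℝ (P ∪ segment ℝ s t) with hCdef
  set D := convexHull ℝ (Q ∪ segment ℝ s t) with hDdef
  set E := convexHull ℝ (P ∪ Q ∪ segment ℝ s t) with hEdef
  have hCK : C ⊆ K := convexHull_min (union_subset hPK hsegK) hK
  have hDK : D ⊆ K := convexHull_min (union_subset hQK hsegK) hK
  have hEK : E ⊆ K := convexHull_min (union_subset (union_subset hPK hQK) hsegK) hK
  have hPC : P ⊆ C := subset_union_left.trans (subset_convexHull ℝ _)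
  have hQD : Q ⊆ D := subset_union_left.trans (subset_convexHull ℝ _)
  have hsC : segment ℝ s t ⊆ C := subset_union_right.trans (subset_convexHull ℝ _)
  have hsD : segment ℝ s t ⊆ D := subset_union_right.trans (subset_convexHull ℝ _)
  have hCE : C ⊆ E := convexHull_mono (union_subset_union_left _ subset_union_left)
  have hDE : D ⊆ E := convexHull_mono (union_subset_union_left _ subset_union_right)
  have hfC : ∀ x ∈ C, side s t s ≤ side s t x := fun x hx =>
    convexHull_min (t := {x | side s t s ≤ side s t x})
      (union_subset (fun p hp => (hP p hp).le) fun z hz => (hside z hz).ge)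
      (convex_halfSpace_ge (side s t).isLinear _) hx
  have hfD : ∀ x ∈ D, side s t x ≤ side s t s := fun x hx =>
    convexHull_min (t := {x | side s t x ≤ side s t s})
      (union_subset (fun p hp => (hQ p hp).le) fun z hz => (hside z hz).le)
      (convex_halfSpace_le (side s t).isLinear _) hx
  have hE : E = C ∪ D := by
    refine (convexHull_min ?_ ?_).antisymm (union_subset hCE hDE)
    · exact union_subset (union_subset (hPC.trans subset_union_left) (hQD.trans subset_union_right))
        (hsC.trans subset_union_left)
    · exact convex_union_of_sides (convex_convexHull ℝ _) (convex_convexHull ℝ _) hK hCK hDK hfC hfD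
        fun z hz hzs => ⟨hsC (hline z hz hzs), hsD (hline z hz hzs)⟩
  obtain ⟨p, hp⟩ := hPne
  obtain ⟨q, hq⟩ := hQne
  have hCi : (interior C).Nonempty := interior_nonempty_of_side_ne (convex_convexHull ℝ _)
    (hsC (left_mem_segment ℝ s t)) (hsC (right_mem_segment ℝ s t)) (hPC hp) (hP p hp).ne'
  have hDi : (interior D).Nonempty := interior_nonempty_of_side_ne (convex_convexHull ℝ _)
    (hsD (left_mem_segment ℝ s t)) (hsD (right_mem_segment ℝ s t)) (hQD hq) (hQ q hq).ne
  have hEi : (interior E).Nonempty := hCi.mono (interior_mono hCE)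
  rw [perimeter_segment hst, perimeter, perimeter, perimeter, if_pos hCi, if_pos hDi, if_pos hEi]
  have hm := (side s t).continuous.measurable
  have hgt : IsOpen {x | side s t s < side s t x} := isOpen_lt continuous_const (side s t).continuous
  have hlt : IsOpen {x | side s t x < side s t s} := isOpen_lt (side s t).continuous continuous_const
  have e1 : frontier E ∩ {x | side s t s < side s t x} =
      frontier C ∩ {x | side s t s < side s t x} := by
    apply frontier_inter_congr hgt
    rw [hE, union_inter_distrib_right, union_eq_left]
    exact fun x hx => absurd hx.2 (hfD x hx.1).not_gt
  have e2 : frontier E ∩ {x | side s t x < side s t s} =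
      frontier D ∩ {x | side s t x < side s t s} := by
    apply frontier_inter_congr hlt
    rw [hE, union_inter_distrib_right, union_eq_right]
    exact fun x hx => absurd hx.2 (hfC x hx.1).not_gt
  have e3 : frontier C ∩ {x | side s t x < side s t s} = ∅ := by
    rw [eq_empty_iff_forall_notMem]
    rintro x ⟨hx, hx'⟩
    have : side s t s ≤ side s t x :=
      closure_minimal hfC (isClosed_le continuous_const (side s t).continuous) hx.1
    exact absurd hx' this.not_gt
  have e4 : frontier D ∩ {x | side s t s < side s t x} = ∅ := by
    rw [eq_empty_iff_forall_notMem]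
    rintro x ⟨hx, hx'⟩
    have : side s t x ≤ side s t s :=
      closure_minimal hfD (isClosed_le (side s t).continuous continuous_const) hx.1
    exact absurd hx' this.not_gt
  have e5 := frontier_inter_line (Or.inl rfl) hst hKc hCK hsC (by simpa using hfC) hline
  have e6 := frontier_inter_line (Or.inr rfl) hst hKc hDK hsD (by simpa using hfD) hline
  -- The open chord is interior to E, so at most s and t remain, and points have length 0.
  have e7 : μH[1] (frontier E ∩ {x | side s t x = side s t s}) = 0 := by
    have hfin : ({s, t} : Set Plane).Finite := toFinite _
    have := Measure.nullSingletonClass_hausdorff Plane one_pos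
    refine measure_mono_null ?_ (hfin.measure_zero _)
    rintro z ⟨hz, hzs⟩
    have hzseg := hline z (closure_minimal hEK hKc hz.1) hzs
    by_contra hne
    simp only [mem_insert_iff, mem_singleton_iff, not_or] at hne
    have hopen := mem_openSegment_of_ne_left_right (Ne.symm hne.1) (Ne.symm hne.2) hzseg
    exact hz.2 (mem_interior_of_openSegment (convex_convexHull ℝ _)
      (hCE (hsC (left_mem_segment ℝ s t))) (hCE (hsC (right_mem_segment ℝ s t))) hst rfl
      (side_right s t) hst (hCE (hPC hp)) (hDE (hQD hq)) (hP p hp) (hQ q hq) hopen)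
  rw [measure_split _ hm (side s t s) (frontier C), measure_split _ hm (side s t s) (frontier D),
    measure_split _ hm (side s t s) (frontier E), e1, e2, e3, e4, e5, e6, e7]
  simp only [measure_empty]
  ring

end

/-! ### Rectifiable curves -/

lemma eVariationOn_le_of_edist_le {f g h : I → Plane}
    (H : ∀ u v, u ≤ v → edist (f u) (f v) ≤ eVariationOn g (Icc u v) + eVariationOn h (Icc u v)) :
    eVariationOn f univ ≤ eVariationOn g univ + eVariationOn h univ := by
  refine iSup_le ?_
  rintro ⟨n, ⟨u, hu, -⟩⟩
  calc ∑ i ∈ Finset.range n, edist (f (u (i + 1))) (f (u i))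
      ≤ ∑ i ∈ Finset.range n, (eVariationOn g (Icc (u i) (u (i + 1))) +
          eVariationOn h (Icc (u i) (u (i + 1)))) :=
        Finset.sum_le_sum fun i _ => by
          rw [edist_comm]
          exact H _ _ (hu (Nat.le_succ i))
    _ = eVariationOn g (Icc (u 0) (u n)) + eVariationOn h (Icc (u 0) (u n)) := by
        rw [Finset.sum_add_distrib, eVariationOn.sum' g hu, eVariationOn.sum' h hu]
    _ ≤ _ := add_le_add (eVariationOn.mono _ (subset_univ _)) (eVariationOn.mono _ (subset_univ _))

lemma exists_mem_frontier_of_isOpen {U S : Set I} (hU : IsOpen U) (hS : IsPreconnected S)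
    (h1 : (S ∩ U).Nonempty) (h2 : (S \ U).Nonempty) : ∃ w ∈ S, w ∈ frontier U := by
  by_contra! h
  rw [hU.frontier_eq] at h
  have hcl : ∀ x ∈ S, x ∉ U → x ∉ closure U := fun x hx hxU hxc => h x hx ⟨hxc, hxU⟩
  obtain ⟨y, hyS, hyU⟩ := h2
  obtain ⟨z, -, hz1, hz2⟩ := hS U (closure U)ᶜ hU isClosed_closure.isOpen_compl
    (fun x hx => by
      by_cases hxU : x ∈ U
      · exact Or.inl hxU
      · exact Or.inr (hcl x hx hxU)) h1 ⟨y, hyS, hcl y hyS hyU⟩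
  exact hz2 (subset_closure hz1)

-- The set `U` may have infinitely many components, so no cutting into finitely many pieces is
-- possible. Instead, any step from `U` to its complement passes a frontier point, where both curves
-- agree.
open Classical in
lemma eVariationOn_piecewise_le {f g : I → Plane} {U : Set I} (hU : IsOpen U)
    (hfg : ∀ u ∈ frontier U, f u = g u) :
    eVariationOn (U.piecewise f g) univ ≤ eVariationOn f univ + eVariationOn g univ := by
  refine eVariationOn_le_of_edist_le fun u v huv => ?_
  have hu : u ∈ Icc u v := left_mem_Icc.2 huv
  have hv : v ∈ Icc u v := right_mem_Icc.2 huv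
  by_cases h1 : u ∈ U <;> by_cases h2 : v ∈ U
  · rw [piecewise_eq_of_mem _ _ _ h1, piecewise_eq_of_mem _ _ _ h2]
    exact (eVariationOn.edist_le f hu hv).trans le_self_add
  · obtain ⟨w, hw, hwU⟩ := exists_mem_frontier_of_isOpen hU isPreconnected_Icc ⟨u, hu, h1⟩
      ⟨v, hv, h2⟩
    rw [piecewise_eq_of_mem _ _ _ h1, piecewise_eq_of_notMem _ _ _ h2]
    refine (edist_triangle _ (f w) _).trans (add_le_add (eVariationOn.edist_le f hu hw) ?_)
    rw [hfg w hwU]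
    exact eVariationOn.edist_le g hw hv
  · obtain ⟨w, hw, hwU⟩ := exists_mem_frontier_of_isOpen hU isPreconnected_Icc ⟨v, hv, h2⟩
      ⟨u, hu, h1⟩
    rw [piecewise_eq_of_notMem _ _ _ h1, piecewise_eq_of_mem _ _ _ h2, add_comm]
    refine (edist_triangle _ (g w) _).trans (add_le_add (eVariationOn.edist_le g hu hw) ?_)
    rw [← hfg w hwU]
    exact eVariationOn.edist_le f hw hv
  · rw [piecewise_eq_of_notMem _ _ _ h1, piecewise_eq_of_notMem _ _ _ h2]
    exact (eVariationOn.edist_le g hu hv).trans le_add_self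

lemma rectifiable_comp_lipschitz {E : Type*} [PseudoEMetricSpace E] {f : E → Plane} {C : NNReal}
    (hf : LipschitzWith C f) {γ : I → E} (hγ : eVariationOn γ univ ≠ ∞) : Rectifiable (f ∘ γ) :=
  ne_top_of_le_ne_top (ENNReal.mul_ne_top ENNReal.coe_ne_top hγ)
    ((hf.lipschitzOnWith (s := univ)).comp_eVariationOn_le (mapsTo_univ _ _))

lemma rectifiable_segment (a b : Plane) : Rectifiable (Path.segment a b) := by
  refine rectifiable_comp_lipschitz (f := AffineMap.lineMap a b) (lipschitzWith_lineMap a b)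
    (γ := fun u : I => (u : ℝ)) ?_
  have hm : MonotoneOn (fun u : I => (u : ℝ)) univ := fun u _ v _ h => h
  exact hm.boundedVariationOn (C := 1) fun u _ => by
    rw [abs_of_nonneg u.2.1]
    exact u.2.2

lemma rectifiable_trans {a b c : Plane} {α : Path a b} {β : Path b c} (hα : Rectifiable α)
    (hβ : Rectifiable β) : Rectifiable (α.trans β) := by
  let m : I := ⟨1 / 2, by norm_num, by norm_num⟩
  have hun : (univ : Set I) = Iic m ∪ Ici m := Iic_union_Ici.symm
  rw [Rectifiable, hun, eVariationOn.union _ isGreatest_Iic isLeast_Ici]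
  refine ENNReal.add_ne_top.2 ⟨?_, ?_⟩
  · let φ : I → I := fun u => projIcc 0 1 zero_le_one (2 * (u : ℝ))
    have hφ : MonotoneOn φ (Iic m) := fun u _ v _ huv =>
      monotone_projIcc _ (mul_le_mul_of_nonneg_left huv zero_le_two)
    have he : EqOn (α.trans β) (α ∘ φ) (Iic m) := by
      intro u hu
      have hu' : (u : ℝ) ≤ 1 / 2 := hu
      rw [Path.trans_apply, dif_pos hu']
      simp only [Function.comp, φ]
      rw [projIcc_of_mem]
    rw [eVariationOn.congr he]
    exact ne_top_of_le_ne_top hα (eVariationOn.comp_le_of_monotoneOn α φ hφ (mapsTo_univ _ _))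
  · let φ : I → I := fun u => projIcc 0 1 zero_le_one (2 * (u : ℝ) - 1)
    have hφ : MonotoneOn φ (Ici m) := fun u _ v _ huv =>
      monotone_projIcc _ (sub_le_sub_right
        (mul_le_mul_of_nonneg_left (show (u : ℝ) ≤ v from huv) zero_le_two) (1 : ℝ))
    have he : EqOn (α.trans β) (β ∘ φ) (Ici m) := by
      intro u hu
      have hu' : (1 / 2 : ℝ) ≤ u := hu
      rcases hu'.eq_or_lt with h | h
      -- At the parameter 1/2 the concatenation is defined by its first path; the value is the
      -- common end.
      · rw [Path.trans_apply, dif_pos h.ge]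
        have h1 : (⟨2 * (u : ℝ), (unitInterval.mul_pos_mem_iff zero_lt_two).2 ⟨u.2.1, h.ge⟩⟩ : I) = 1 := by
          ext
          simp [← h]
        have h2 : φ u = 0 := by
          simp only [φ, ← h]
          norm_num
        simp [h1, h2]
      · rw [Path.trans_apply, dif_neg h.not_ge]
        simp only [Function.comp, φ]
        rw [projIcc_of_mem]
    rw [eVariationOn.congr he]
    exact ne_top_of_le_ne_top hβ (eVariationOn.comp_le_of_monotoneOn β φ hφ (mapsTo_univ _ _))

/-! ### Points that a concatenated path passes exactly once -/

lemma existsUnique_trans_left {a b c p : Plane} {α : Path a b} {β : Path b c}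
    (hα : ∃! u, α u = p) (hβ : p ∉ range β) : ∃! u, α.trans β u = p := by
  obtain ⟨u, hu, huniq⟩ := hα
  have hu0 := u.2.1
  have hu1 := u.2.2
  have hle : (u : ℝ) / 2 ≤ 1 / 2 := by linarith
  refine ⟨⟨u / 2, by linarith, by linarith⟩, ?_, fun v hv => ?_⟩
  · simp only
    rw [Path.trans_apply, dif_pos hle, ← hu]
    congr 1
    ext
    simp only
    ring
  · simp only at hv
    rw [Path.trans_apply] at hv
    split_ifs at hv with h
    · have := congrArg Subtype.val (huniq _ hv)
      ext
      simp only at this ⊢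
      linarith
    · exact absurd ⟨_, hv⟩ hβ

lemma existsUnique_trans_right {a b c p : Plane} {α : Path a b} {β : Path b c}
    (hα : p ∉ range α) (hβ : ∃! u, β u = p) : ∃! u, α.trans β u = p := by
  obtain ⟨u, hu, huniq⟩ := hβ
  have hu0 := u.2.1
  have hu1 := u.2.2
  have hpos : (u : ℝ) ≠ 0 := by
    intro h
    have : u = 0 := Subtype.ext h
    subst this
    exact hα ⟨1, by simpa using hu⟩
  have hlt : 0 < (u : ℝ) := lt_of_le_of_ne hu0 hpos.symm
  have hnle : ¬ ((u : ℝ) + 1) / 2 ≤ 1 / 2 := by linarith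
  refine ⟨⟨(u + 1) / 2, by linarith, by linarith⟩, ?_, fun v hv => ?_⟩
  · simp only
    rw [Path.trans_apply, dif_neg hnle, ← hu]
    congr 1
    ext
    simp only
    ring
  · simp only at hv
    rw [Path.trans_apply] at hv
    split_ifs at hv with h
    · exact absurd ⟨_, hv⟩ hα
    · have := congrArg Subtype.val (huniq _ hv)
      ext
      simp only at this ⊢
      linarith

/-! ### The retraction onto a segment -/

/-- The orthogonal projection to the line through `s`, `t`, followed by the retraction of the line
onto the segment. -/
def toSegment (s t x : Plane) : Plane :=
  AffineMap.lineMap s t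
    (projIcc (0 : ℝ) 1 zero_le_one ((‖t - s‖ ^ 2)⁻¹ * inner ℝ (t - s) (x - s)) : ℝ)

lemma toSegment_mem (s t x : Plane) : toSegment s t x ∈ segment ℝ s t := by
  rw [segment_eq_image_lineMap]
  exact ⟨_, Subtype.coe_prop _, rfl⟩

lemma toSegment_eq_self {s t x : Plane} (hst : s ≠ t) (hx : x ∈ segment ℝ s t) :
    toSegment s t x = x := by
  rw [segment_eq_image_lineMap] at hx
  obtain ⟨μ, hμ, rfl⟩ := hx
  have hn : ‖t - s‖ ≠ 0 := norm_ne_zero_iff.2 (sub_ne_zero.2 hst.symm)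
  have : (‖t - s‖ ^ 2)⁻¹ * inner ℝ (t - s) (AffineMap.lineMap s t μ - s) = μ := by
    rw [AffineMap.lineMap_apply_module', add_sub_cancel_right, inner_smul_right,
      real_inner_self_eq_norm_sq]
    field_simp
  rw [toSegment, this, projIcc_of_mem _ hμ]

lemma exists_lipschitz_toSegment (s t : Plane) : ∃ C, LipschitzWith C (toSegment s t) := by
  have h1 : LipschitzWith _ fun x : Plane => ((‖t - s‖ ^ 2)⁻¹ • innerSL ℝ (t - s)) (x - s) :=
    ((‖t - s‖ ^ 2)⁻¹ • innerSL ℝ (t - s)).lipschitz.comp (LipschitzWith.id.sub (.const s))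
  have h2 := (lipschitzWith_lineMap (𝕜 := ℝ) s t).comp
    ((LipschitzWith.subtype_val _).comp ((LipschitzWith.projIcc (zero_le_one (α := ℝ))).comp h1))
  exact ⟨_, h2⟩

/-! ### The route through the inner parts -/

section

variable {s t : Plane} {X Y : Path s t} {p : Plane}

/-- On a disc that misses both paths the difference of the two angles is constant. -/
lemma isOpen_between (Y Z : Path s t) : IsOpen {p | Between p Y Z} := by
  rw [isOpen_iff_mem_nhds]
  intro p hp
  have hO : IsOpen ((range Y)ᶜ ∩ (range Z)ᶜ) :=
    (isCompact_range Y.continuous).isClosed.isOpen_compl.inter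
      (isCompact_range Z.continuous).isClosed.isOpen_compl
  obtain ⟨r, hr, hball⟩ := Metric.isOpen_iff.1 hO p ⟨hp.1, hp.2.1⟩
  refine mem_of_superset (Metric.ball_mem_nhds p hr) fun q hq => ?_
  have := logChange_sub_const (X := Y) (Y := Z) (convex_ball p r).isPreconnected
    (disjoint_left.2 fun x hx => (hball hx).1) (disjoint_left.2 fun x hx => (hball hx).2)
    hq (Metric.mem_ball_self hr)
  have hp' := (between_iff.1 hp).2.2
  exact between_iff.2 ⟨(hball hq).1, (hball hq).2, fun h => hp' (sub_eq_zero.1 (by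
    rw [← this, h, sub_self]))⟩

lemma isOpen_not_between (Y Z : Path s t) :
    IsOpen {p | p ∉ range Y ∧ p ∉ range Z ∧ ¬ Between p Y Z} := by
  rw [isOpen_iff_mem_nhds]
  rintro p ⟨hpY, hpZ, hp⟩
  have hO : IsOpen ((range Y)ᶜ ∩ (range Z)ᶜ) :=
    (isCompact_range Y.continuous).isClosed.isOpen_compl.inter
      (isCompact_range Z.continuous).isClosed.isOpen_compl
  obtain ⟨r, hr, hball⟩ := Metric.isOpen_iff.1 hO p ⟨hpY, hpZ⟩
  refine mem_of_superset (Metric.ball_mem_nhds p hr) fun q hq => ?_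
  have := logChange_sub_const (X := Y) (Y := Z) (convex_ball p r).isPreconnected
    (disjoint_left.2 fun x hx => (hball hx).1) (disjoint_left.2 fun x hx => (hball hx).2)
    hq (Metric.mem_ball_self hr)
  refine ⟨(hball hq).1, (hball hq).2, fun h => hp ?_⟩
  exact between_iff.2 ⟨hpY, hpZ, fun he => (between_iff.1 h).2.2 (sub_eq_zero.1 (by
    rw [this, he, sub_self]))⟩

lemma notMem_segment_of_mem_innerPart (hp : p ∈ innerPart X Y) : p ∉ segment ℝ s t := by
  have := hp.2.2.1
  rwa [Path.range_segment] at this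

/-- The curve that follows `X` in its inner part and the segment otherwise. -/
lemma exists_inner_route (hst : s ≠ t) (hXY : MeetAtEnds X Y) (hinj : Function.Injective X)
    (hX : Rectifiable X) :
    ∃ γ : Path s t, Rectifiable γ ∧ range γ ⊆ innerPart X Y ∪ segment ℝ s t ∧
      ∀ p ∈ innerPart X Y, ∃! u, γ u = p := by
  classical
  let U : Set I := {u | Between (X u) Y (Path.segment s t)}
  have hU : IsOpen U := (isOpen_between _ _).preimage X.continuous
  -- Off Y and the segment, lying between and not lying between are both open conditions. So X can
  -- leave its inner part only on Y or on the segment, and it meets Y only at s and t, which are on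
  -- the segment too.
  have hfr : ∀ u ∈ frontier U, X u = toSegment s t (X u) := by
    intro u hu
    rw [hU.frontier_eq] at hu
    refine (toSegment_eq_self hst ?_).symm
    by_contra hseg
    have hV : IsOpen (X ⁻¹' {p | p ∉ range Y ∧ p ∉ range (Path.segment s t) ∧
        ¬ Between p Y (Path.segment s t)}) := (isOpen_not_between _ _).preimage X.continuous
    have huY : X u ∉ range Y := hXY.symm.notMem
      (fun h => hseg (by rw [h, X.source]; exact left_mem_segment ℝ s t))
      (fun h => hseg (by rw [h, X.target]; exact right_mem_segment ℝ s t))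
    obtain ⟨v, hv1, hv2⟩ := mem_closure_iff.1 hu.1 _ hV
      ⟨huY, by rwa [Path.range_segment], hu.2⟩
    exact hv1.2.2 hv2
  obtain ⟨C, hC⟩ := exists_lipschitz_toSegment s t
  have hend : ∀ u, X u ∈ segment ℝ s t → U.piecewise X (toSegment s t ∘ X) u = X u := by
    intro u hu
    by_cases h : u ∈ U
    · exact piecewise_eq_of_mem _ _ _ h
    · rw [piecewise_eq_of_notMem _ _ _ h]
      exact toSegment_eq_self hst hu
  have hcont : Continuous (U.piecewise X (toSegment s t ∘ X)) :=
    Continuous.piecewise hfr X.continuous (hC.continuous.comp X.continuous)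
  let γ : Path s t :=
    { toFun := U.piecewise X (toSegment s t ∘ X)
      continuous_toFun := hcont
      source' := by
        rw [hend 0 (by rw [X.source]; exact left_mem_segment ℝ s t), X.source]
      target' := by
        rw [hend 1 (by rw [X.target]; exact right_mem_segment ℝ s t), X.target] }
  have hγ1 : ∀ u ∈ U, γ u = X u := fun u hu => piecewise_eq_of_mem _ _ _ hu
  have hγ2 : ∀ u ∉ U, γ u = toSegment s t (X u) := fun u hu => piecewise_eq_of_notMem _ _ _ hu
  refine ⟨γ, ?_, ?_, ?_⟩
  · exact ne_top_of_le_ne_top (ENNReal.add_ne_top.2 ⟨hX, rectifiable_comp_lipschitz hC hX⟩)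
      (eVariationOn_piecewise_le hU hfr)
  · rintro _ ⟨u, rfl⟩
    by_cases h : u ∈ U
    · rw [hγ1 u h]
      exact Or.inl ⟨⟨u, rfl⟩, h⟩
    · rw [hγ2 u h]
      exact Or.inr (toSegment_mem s t _)
  · intro p hp
    obtain ⟨⟨u, rfl⟩, hu⟩ := id hp
    refine ⟨u, hγ1 u hu, fun v hv => ?_⟩
    simp only at hv
    by_cases h : v ∈ U
    · rw [hγ1 v h] at hv
      exact hinj hv
    · rw [hγ2 v h] at hv
      exact absurd (hv ▸ toSegment_mem s t _) (notMem_segment_of_mem_innerPart hp)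

/-- The single route that runs through both inner parts and back along the segment. -/
lemma exists_route_through_innerParts (hst : s ≠ t) (hXY : MeetAtEnds X Y)
    (hXinj : Function.Injective X) (hYinj : Function.Injective Y) (hX : Rectifiable X)
    (hY : Rectifiable Y) :
    ∃ γ : Path s t, Rectifiable γ ∧ range γ = innerPart X Y ∪ innerPart Y X ∪ segment ℝ s t ∧
      ConsistsOfParts γ (innerPart X Y ∪ innerPart Y X) := by
  obtain ⟨α, hα, hαr, hαu⟩ := exists_inner_route hst hXY hXinj hX
  obtain ⟨β, hβ, hβr, hβu⟩ := exists_inner_route hst hXY.symm hYinj hY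
  have hdisj : ∀ p ∈ innerPart X Y, p ∉ innerPart Y X := fun p hp hq => hp.2.1 hq.1
  have hrange : range (α.trans ((Path.segment t s).trans β)) =
      innerPart X Y ∪ innerPart Y X ∪ segment ℝ s t := by
    rw [Path.trans_range, Path.trans_range, Path.range_segment, segment_symm]
    apply Subset.antisymm
    · rintro p (hp | hp | hp)
      · rcases hαr hp with h | h
        · exact Or.inl (Or.inl h)
        · exact Or.inr h
      · exact Or.inr hp
      · rcases hβr hp with h | h
        · exact Or.inl (Or.inr h)
        · exact Or.inr h
    · rintro p ((hp | hp) | hp)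
      · exact Or.inl (hαu p hp).exists
      · exact Or.inr (Or.inr (hβu p hp).exists)
      · exact Or.inr (Or.inl hp)
  -- The return along l(s,t) covers the whole segment, so (s, t) is the only connecting segment
  -- needed.
  refine ⟨α.trans ((Path.segment t s).trans β),
    rectifiable_trans hα (rectifiable_trans (rectifiable_segment t s) hβ), hrange,
    ⟨{(s, t)}, finite_singleton _, ?_, ?_⟩, ?_⟩
  · rintro e rfl
    exact ⟨Or.inr (Or.inl rfl), Or.inr (Or.inr rfl)⟩
  · rw [hrange, biUnion_singleton]
  · rintro p (hp | hp)
    · refine existsUnique_trans_left (hαu p hp) ?_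
      rw [Path.trans_range, Path.range_segment, segment_symm]
      rintro (h | h)
      · exact notMem_segment_of_mem_innerPart hp h
      · rcases hβr h with h | h
        · exact hdisj p hp h
        · exact notMem_segment_of_mem_innerPart hp h
    · refine existsUnique_trans_right ?_ (existsUnique_trans_right ?_ (hβu p hp))
      · intro h
        rcases hαr h with h | h
        · exact hdisj p h hp
        · exact notMem_segment_of_mem_innerPart hp h
      · rw [Path.range_segment, segment_symm]
        exact notMem_segment_of_mem_innerPart hp

end

/-! ### Arc length and the division of links -/

lemma eVariationOn_Iic_add (γ : I → Plane) {u v : I} (h : u ≤ v) :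
    eVariationOn γ (Iic u) + eVariationOn γ (Icc u v) = eVariationOn γ (Iic v) := by
  rw [← eVariationOn.union γ isGreatest_Iic (isLeast_Icc h), Iic_union_Icc_eq_Iic h]

lemma Rectifiable.ne_top {γ : I → Plane} (h : Rectifiable γ) (S : Set I) :
    eVariationOn γ S ≠ ∞ :=
  ne_top_of_le_ne_top h (eVariationOn.mono _ (subset_univ _))

lemma arcLength_sub {γ : I → Plane} (h : Rectifiable γ) {u v : I} (huv : u ≤ v) :
    arcLength γ v - arcLength γ u = (eVariationOn γ (Icc u v)).toReal := by
  rw [arcLength, arcLength, ← eVariationOn_Iic_add γ huv,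
    ENNReal.toReal_add (h.ne_top _) (h.ne_top _), add_sub_cancel_left]

lemma continuous_arcLength {γ : I → Plane} (hγ : Continuous γ) (h : Rectifiable γ) :
    Continuous (arcLength γ) := by
  rw [continuous_iff_continuousAt]
  intro u
  have hb : BoundedVariationOn γ univ := h
  have h1 := hb.tendsto_eVariationOn_Icc_zero_left (x := u) hγ.continuousWithinAt
  have h2 := hb.tendsto_eVariationOn_Icc_zero_right u hγ.continuousWithinAt
  simp only [univ_inter, nhdsWithin_univ] at h1 h2
  have h3 := ((ENNReal.tendsto_toReal ENNReal.zero_ne_top).comp h1).add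
    ((ENNReal.tendsto_toReal ENNReal.zero_ne_top).comp h2)
  simp only [Function.comp_def, ENNReal.toReal_zero, add_zero] at h3
  rw [ContinuousAt, tendsto_iff_dist_tendsto_zero]
  refine squeeze_zero (fun _ => dist_nonneg) (fun v => ?_) h3
  rcases le_total u v with huv | huv
  · rw [Real.dist_eq, arcLength_sub h huv, abs_of_nonneg ENNReal.toReal_nonneg]
    exact le_add_of_nonneg_left ENNReal.toReal_nonneg
  · rw [dist_comm, Real.dist_eq, arcLength_sub h huv, abs_of_nonneg ENNReal.toReal_nonneg]
    exact le_add_of_nonneg_right ENNReal.toReal_nonneg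

/-- The arc is stopped when it first reaches a small distance δ from its start; until then it stays
in a ball inside `D`. -/
lemma exists_Icc_of_le {f : I → Plane} (hf : Continuous f) {D : Set Plane} (hD : IsOpen D) {u v : I}
    (huv : u ≤ v) (hu : f u ∈ D) (hne : f v ≠ f u) :
    ∃ b, u ≤ b ∧ (∀ x ∈ Icc u b, f x ∈ D) ∧ f u ≠ f b := by
  obtain ⟨δ', hδ', hball⟩ := Metric.isOpen_iff.1 hD _ hu
  have hpos : 0 < dist (f v) (f u) := dist_pos.2 hne
  obtain ⟨δ, hδ0, hδ⟩ := exists_between (lt_min hδ' hpos)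
  have hδ1 := hδ.trans_le (min_le_left _ _)
  have hδ2 := hδ.trans_le (min_le_right _ _)
  have hdc : Continuous fun x => dist (f x) (f u) := by fun_prop
  have ivt : ∀ w, u ≤ w → δ ≤ dist (f w) (f u) → ∃ x ∈ Icc u w, dist (f x) (f u) = δ := by
    intro w huw hw
    exact isPreconnected_Icc.intermediate_value (left_mem_Icc.2 huw) (right_mem_Icc.2 huw)
      hdc.continuousOn ⟨by simpa using hδ0.le, hw⟩
  obtain ⟨w, hw, hwδ⟩ := ivt v huv hδ2.le
  obtain ⟨b, ⟨hub, hb⟩, hb'⟩ : ∃ b, IsLeast {x | u ≤ x ∧ dist (f x) (f u) = δ} b :=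
    (isClosed_Ici.inter (isClosed_eq hdc continuous_const)).isCompact.exists_isLeast
      ⟨w, hw.1, hwδ⟩
  refine ⟨b, hub, fun x hx => hball ?_, fun h => ?_⟩
  · rw [Metric.mem_ball]
    by_contra! hxd
    obtain ⟨y, hy, hyδ⟩ := ivt x hx.1 (hδ1.le.trans hxd)
    have hyx : y ≠ x := by
      rintro rfl
      linarith
    exact (lt_of_le_of_ne hy.2 hyx).not_ge (hx.2.trans (hb' ⟨hy.1, hyδ⟩))
  · rw [h, dist_self] at hb
    exact hδ0.ne hb

lemma exists_Icc_subset {f : I → Plane} (hf : Continuous f) {D : Set Plane} (hD : IsOpen D) {u v : I}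
    (hu : f u ∈ D) (hne : f v ≠ f u) :
    ∃ a b, a ≤ b ∧ (∀ x ∈ Icc a b, f x ∈ D) ∧ f a ≠ f b := by
  rcases le_total u v with h | h
  · obtain ⟨b, h1, h2, h3⟩ := exists_Icc_of_le hf hD h hu hne
    exact ⟨u, b, h1, h2, h3⟩
  · obtain ⟨b, h1, h2, h3⟩ := exists_Icc_of_le (f := f ∘ unitInterval.symm)
      (hf.comp unitInterval.continuous_symm) hD (unitInterval.symm_le_symm.2 h)
      (by simpa using hu) (by simpa using hne)
    refine ⟨unitInterval.symm b, u, by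
      simpa using unitInterval.symm_le_symm.2 h1, fun x hx => ?_, ?_⟩
    · have := h2 (unitInterval.symm x) ⟨unitInterval.symm_le_symm.2 hx.2, by
        simpa using unitInterval.symm_le_symm.2 hx.1⟩
      simpa using this
    · simpa using h3.symm

lemma eventually_destroyable {γ : I → Plane} (hγ : Continuous γ) (h : Rectifiable γ) {D : Set Plane}
    (hD : IsOpen D) {u v : I} (hu : γ u ∈ D) (hne : γ v ≠ γ u) {r : ℝ} (hr0 : 0 < r) (hr1 : r < 1) :
    ∀ᶠ ε in 𝓝[>] (0 : ℝ), (destroyable r ε γ ∩ D).Nonempty := by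
  obtain ⟨a, b, hab, hsub, hne'⟩ := exists_Icc_subset hγ hD hu hne
  have hlt : 0 < arcLength γ b - arcLength γ a := by
    rw [arcLength_sub h hab]
    refine ENNReal.toReal_pos (fun h0 => hne' ?_) (h.ne_top _)
    have := eVariationOn.edist_le γ (left_mem_Icc.2 hab) (right_mem_Icc.2 hab)
    rw [h0, nonpos_iff_eq_zero] at this
    exact edist_eq_zero.1 this
  -- Two periods fit into the arc: one to reach the next multiple of ε, one to contain the point r ε
  -- after it, where an unprotected part starts.
  have hev : Ioo 0 ((arcLength γ b - arcLength γ a) / 2) ∈ 𝓝[>] (0 : ℝ) :=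
    Ioo_mem_nhdsGT (half_pos hlt)
  filter_upwards [hev] with ε hε
  have h1 := Int.le_ceil (arcLength γ a / ε)
  have h2 := Int.ceil_lt_add_one (arcLength γ a / ε)
  set k := ⌈arcLength γ a / ε⌉
  rw [div_le_iff₀ hε.1] at h1
  have h3 : ((k : ℝ) - 1) * ε < arcLength γ a := by
    rw [← lt_div_iff₀ hε.1]
    linarith
  have h4 : r * ε < 1 * ε := mul_lt_mul_of_pos_right hr1 hε.1
  have h5 : 0 < r * ε := mul_pos hr0 hε.1
  obtain ⟨x, hx, hxk⟩ := isPreconnected_Icc.intermediate_value (left_mem_Icc.2 hab)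
    (right_mem_Icc.2 hab) (continuous_arcLength hγ h).continuousOn
    (show ((k : ℝ) + r) * ε ∈ _ from ⟨by linarith, by linarith [hε.2]⟩)
  refine ⟨γ x, ⟨x, rfl, ?_⟩, hsub x hx⟩
  rw [hxk, mul_div_cancel_right₀ _ hε.1.ne', Int.fract_intCast_add,
    Int.fract_eq_self.2 ⟨hr0.le, hr1⟩]

/-! ### The weakest arrangement -/

/-- A constant link has length 0 and is never destroyed. But the route has infinitely many points in
`D`, and the finitely many constant links account for only finitely many of them. -/
lemma exists_link_meets {s t : Plane} (N : Network s t) (hst : s ≠ t) {D : Set Plane}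
    (hD : IsOpen D) {i : Fin N.numRoutes} (h : (range (N.route i) ∩ D).Nonempty) :
    ∃ l ∈ N.linksOf i, ∃ u v, N.link l u ∈ D ∧ N.link l v ≠ N.link l u := by
  by_contra! hcon
  obtain ⟨_, ⟨u, rfl⟩, hu⟩ := h
  have hv : ∃ v, N.route i v ≠ N.route i u := by
    by_contra! hv
    exact hst ((N.route i).source.symm.trans ((hv 0).trans ((hv 1).symm.trans (N.route i).target)))
  obtain ⟨v, hv⟩ := hv
  obtain ⟨a, b, hab, hsub, hne⟩ := exists_Icc_subset (N.route i).continuous hD hu hv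
  have hinf : (N.route i '' Icc a b).Infinite :=
    (isPreconnected_Icc.image _ (N.route i).continuous.continuousOn).infinite_of_nontrivial
      ⟨_, ⟨a, left_mem_Icc.2 hab, rfl⟩, _, ⟨b, right_mem_Icc.2 hab, rfl⟩, hne⟩
  apply hinf
  have hfin : (⋃ l ∈ N.linksOf i, range (N.link l) ∩ D).Finite := by
    refine (toFinite (N.linksOf i)).biUnion fun l hl => Subsingleton.finite ?_
    rintro _ ⟨⟨x, rfl⟩, hx⟩ _ ⟨⟨y, rfl⟩, hy⟩
    exact (hcon l hl x y hx).symm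
  refine hfin.subset ?_
  rintro _ ⟨x, hx, rfl⟩
  have hmem : N.route i x ∈ range (N.route i) := ⟨x, rfl⟩
  rw [N.range_route i] at hmem
  simp only [mem_iUnion] at hmem ⊢
  obtain ⟨l, hl, hxl⟩ := hmem
  exact ⟨l, hl, hxl, hsub x hx⟩

lemma eventually_connects_iff {s t : Plane} (N : Network s t) (hst : s ≠ t) {D : Set Plane}
    (hD : IsOpen D) {r : ℝ} (hr0 : 0 < r) (hr1 : r < 1) :
    ∀ᶠ ε in 𝓝[>] (0 : ℝ), N.Connects r ε D ↔ ∃ i, range (N.route i) ∩ D = ∅ := by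
  have key : ∀ i, ∀ᶠ ε in 𝓝[>] (0 : ℝ),
      (∀ l ∈ N.linksOf i, destroyable r ε (N.link l) ∩ D = ∅) → range (N.route i) ∩ D = ∅ := by
    intro i
    by_cases h : range (N.route i) ∩ D = ∅
    · exact Eventually.of_forall fun _ _ => h
    · obtain ⟨l, hl, u, v, hu, hv⟩ := exists_link_meets N hst hD (nonempty_iff_ne_empty.2 h)
      filter_upwards [eventually_destroyable (N.link l).continuous (N.link_rectifiable l) hD hu hv
        hr0 hr1] with ε hε hall
      exact absurd (hall l hl) hε.ne_empty
  filter_upwards [eventually_all.2 key] with ε hε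
  constructor
  · rintro ⟨i, hi⟩
    exact ⟨i, hε i hi⟩
  · rintro ⟨i, hi⟩
    refine ⟨i, fun l hl => subset_empty_iff.1 ?_⟩
    rw [← hi, N.range_route i]
    rintro x ⟨⟨u, rfl, -⟩, hx⟩
    exact ⟨mem_biUnion hl ⟨u, rfl⟩, hx⟩

/-! ### Half planes: topology, convexity, measurability and finite measure -/

lemma inner_unitVec (x : Plane) (θ : ℝ) :
    inner ℝ x (unitVec θ) = x 0 * Real.cos θ + x 1 * Real.sin θ := by
  simp [unitVec, PiLp.inner_apply, Fin.sum_univ_two, mul_comm]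

lemma isOpen_setOf_mem_rightHalfPlane (x : Plane) : IsOpen {G : DirLine | x ∈ rightHalfPlane G} := by
  have hc : Continuous fun G : DirLine => inner ℝ x (unitVec G.2.1) := by
    simp only [inner_unitVec]
    fun_prop
  have hb : ∀ b : Bool, IsOpen {G : DirLine | G.2.2 = b} := fun b =>
    (isOpen_discrete {b}).preimage (continuous_snd.comp continuous_snd)
  have : {G : DirLine | x ∈ rightHalfPlane G} =
      ({G | G.2.2 = true} ∩ {G | G.1 < inner ℝ x (unitVec G.2.1)}) ∪
        ({G | G.2.2 = false} ∩ {G | inner ℝ x (unitVec G.2.1) < G.1}) := by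
    ext ⟨ρ, θ, _ | _⟩ <;> simp [rightHalfPlane]
  rw [this]
  exact ((hb _).inter (isOpen_lt continuous_fst hc)).union
    ((hb _).inter (isOpen_lt hc continuous_fst))

/-- The half planes that meet S form a union of open sets, so S may be arbitrary; this covers the
destroyable parts. -/
lemma measurableSet_inter_rightHalfPlane_eq_empty (S : Set Plane) :
    MeasurableSet {G : DirLine | S ∩ rightHalfPlane G = ∅} := by
  have : {G : DirLine | S ∩ rightHalfPlane G = ∅} =
      (⋃ x ∈ S, {G : DirLine | x ∈ rightHalfPlane G})ᶜ := by
    ext G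
    simp [eq_empty_iff_forall_notMem]
  rw [this]
  exact (isOpen_biUnion fun x _ => isOpen_setOf_mem_rightHalfPlane x).measurableSet.compl

lemma isOpen_rightHalfPlane (G : DirLine) : IsOpen (rightHalfPlane G) := by
  unfold rightHalfPlane
  split_ifs
  · exact isOpen_lt continuous_const (by fun_prop)
  · exact isOpen_lt (by fun_prop) continuous_const

lemma convex_rightHalfPlane (G : DirLine) : Convex ℝ (rightHalfPlane G) := by
  have hl : IsLinearMap ℝ fun x : Plane => inner ℝ x (unitVec G.2.1) :=
    ⟨fun x y => inner_add_left _ _ _, fun c x => by simp [inner_smul_left]⟩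
  unfold rightHalfPlane
  split_ifs
  · exact convex_halfSpace_gt hl _
  · exact convex_halfSpace_lt hl _

lemma convex_compl_rightHalfPlane (G : DirLine) : Convex ℝ (rightHalfPlane G)ᶜ := by
  have hl : IsLinearMap ℝ fun x : Plane => inner ℝ x (unitVec G.2.1) :=
    ⟨fun x y => inner_add_left _ _ _, fun c x => by simp [inner_smul_left]⟩
  unfold rightHalfPlane
  split_ifs
  · rw [show {x : Plane | G.1 < inner ℝ x (unitVec G.2.1)}ᶜ =
      {x | inner ℝ x (unitVec G.2.1) ≤ G.1} from Set.ext fun x => by simp]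
    exact convex_halfSpace_le hl _
  · rw [show {x : Plane | inner ℝ x (unitVec G.2.1) < G.1}ᶜ =
      {x | G.1 ≤ inner ℝ x (unitVec G.2.1)} from Set.ext fun x => by simp]
    exact convex_halfSpace_ge hl _

lemma lineMeasure_lt_top {Ω : Set Plane} (hΩ : Bornology.IsBounded Ω) :
    lineMeasure {G | (linePoints G ∩ Ω).Nonempty} < ∞ := by
  obtain ⟨M, hM⟩ := hΩ.exists_norm_le
  have hsub : {G : DirLine | (linePoints G ∩ Ω).Nonempty} ⊆ Iic M ×ˢ univ := by
    rintro G ⟨x, hx, hxΩ⟩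
    refine ⟨?_, mem_univ _⟩
    have hx' : inner ℝ x (unitVec G.2.1) = G.1 := hx
    have hu : ‖unitVec G.2.1‖ = 1 := by
      simp [unitVec, EuclideanSpace.norm_eq, Fin.sum_univ_two]
    have := real_inner_le_norm x (unitVec G.2.1)
    rw [hx', hu, mul_one] at this
    exact this.trans (hM x hxΩ)
  refine (measure_mono hsub).trans_lt ?_
  rw [lineMeasure, Measure.prod_prod, ← univ_prod_univ, Measure.prod_prod]
  refine ENNReal.mul_lt_top ?_ (ENNReal.mul_lt_top (measure_lt_top _ _) ?_)
  · rw [Measure.restrict_apply measurableSet_Iic, inter_comm, Ici_inter_Iic]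
    exact measure_Icc_lt_top
  · rw [Measure.smul_apply, smul_eq_mul]
    exact ENNReal.mul_lt_top (by simp) (by simp)

/-- Under the weakest arrangement, `s` and `t` stay connected iff some route avoids the disaster. -/
lemma weakestPr_lineProb {s t : Plane} (N : Network s t) (hst : s ≠ t) {Ω : Set Plane}
    (hΩ : Bornology.IsBounded Ω) {r : ℝ} (hr0 : 0 < r) (hr1 : r < 1) :
    N.WeakestPr Ω r (lineProb Ω {G | ∃ i, range (N.route i) ∩ rightHalfPlane G = ∅}) := by
  set A : Set DirLine := {G | (linePoints G ∩ Ω).Nonempty} with hA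
  have : IsFiniteMeasure (lineMeasure.restrict A) :=
    ⟨by rw [Measure.restrict_apply_univ]; exact lineMeasure_lt_top hΩ⟩
  have hmeas : ∀ ε, MeasurableSet {G | N.Connects r ε (rightHalfPlane G)} := by
    intro ε
    have : {G | N.Connects r ε (rightHalfPlane G)} = ⋃ i, ⋂ l ∈ N.linksOf i,
        {G | destroyable r ε (N.link l) ∩ rightHalfPlane G = ∅} := by
      ext G
      simp [Network.Connects]
    rw [this]
    exact MeasurableSet.iUnion fun i => MeasurableSet.biInter (to_countable _)
      fun l _ => measurableSet_inter_rightHalfPlane_eq_empty _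
  -- For each fixed G the event is eventually constant as ε → 0. Boundedness of Ω makes the measure
  -- finite, so pointwise convergence of indicators suffices.
  have hlim := tendsto_measure_of_tendsto_indicator_of_isFiniteMeasure (𝓝[>] (0 : ℝ))
    (lineMeasure.restrict A) hmeas
    (A := {G | ∃ i, range (N.route i) ∩ rightHalfPlane G = ∅})
    (fun G => eventually_connects_iff N hst (isOpen_rightHalfPlane G) hr0 hr1)
  have hmeas' : MeasurableSet {G | ∃ i, range (N.route i) ∩ rightHalfPlane G = ∅} := by
    rw [ofPred_exists]
    exact MeasurableSet.iUnion fun i => measurableSet_inter_rightHalfPlane_eq_empty _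
  simp only [Measure.restrict_apply (hmeas _), Measure.restrict_apply hmeas', inter_comm _ A] at hlim
  unfold Network.WeakestPr Network.prConnect lineProb
  by_cases h0 : lineMeasure A = 0
  -- Here all the quotients are 0 / 0 = 0.
  · have hz : ∀ X, lineMeasure (A ∩ X) = 0 := fun X => measure_mono_null inter_subset_left h0
    simp only [← hA, hz, ENNReal.zero_div]
    exact tendsto_const_nhds
  · exact ENNReal.Tendsto.div_const hlim (Or.inr h0)

/-! ### Almost convex networks -/

section

variable {s t : Plane} {N : Network s t} {i j : Fin N.numRoutes}

lemma Network.IsOuterPair.ne_ends (h : N.IsOuterPair i j) : s ≠ t := fun he =>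
  zero_ne_one (h.simple_left
    ((N.route i).source.trans (he.trans (N.route i).target.symm)) : (0 : I) = 1)

lemma Network.IsOuterPair.meetAtEnds (h : N.IsOuterPair i j) :
    MeetAtEnds (N.route i) (N.route j) := by
  intro u v huv
  rcases h.disjoint_left j h.ne.symm ⟨⟨u, rfl⟩, ⟨v, huv.symm⟩⟩ with hs | ht
  · exact Or.inl ⟨h.simple_left (hs.trans (N.route i).source.symm),
      h.simple_right (huv.symm.trans (hs.trans (N.route j).source.symm))⟩
  · exact Or.inr ⟨h.simple_left (ht.trans (N.route i).target.symm),
      h.simple_right (huv.symm.trans (ht.trans (N.route j).target.symm))⟩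

lemma source_mem_range (X : Path s t) : s ∈ range X := ⟨0, X.source⟩

lemma target_mem_range (X : Path s t) : t ∈ range X := ⟨1, X.target⟩

/-- A half plane that avoids a path avoids the inner part with respect to this path. -/
lemma notMem_of_mem_innerPart {X Y : Path s t} {R : Set Plane} (hR : Convex ℝ Rᶜ)
    (hY : range Y ∩ R = ∅) {p : Plane} (hp : p ∈ innerPart X Y) : p ∉ R := by
  intro hpR
  have hYR : range Y ⊆ Rᶜ := fun x hx hxR => (hY ▸ (⟨hx, hxR⟩ : x ∈ range Y ∩ R) : x ∈ (∅ : Set Plane))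
  refine not_between_of_convex hR hYR ?_ (not_not.2 hpR) hp.2
  rw [Path.range_segment]
  exact hR.segment_subset (hYR (source_mem_range Y)) (hYR (target_mem_range Y))

/-- A half plane avoids some route of an almost convex network iff it avoids the inner parts and
the segment. -/
lemma exists_route_avoids_iff (houter : N.IsOuterPair i j) (hconv : N.AlmostConvex i j)
    {R : Set Plane} (hR : Convex ℝ R) (hR' : Convex ℝ Rᶜ) :
    (∃ k, range (N.route k) ∩ R = ∅) ↔
      (innerPart (N.route i) (N.route j) ∪ innerPart (N.route j) (N.route i) ∪ segment ℝ s t) ∩ R =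
        ∅ := by
  have hst := houter.ne_ends
  have hXY := houter.meetAtEnds
  obtain ⟨lS, lT, hS, hT⟩ := exists_branchLogs hst hXY hconv.1.2 hconv.2.2
  have hK := convex_convexHull ℝ (range (N.route i) ∪ range (N.route j))
  constructor
  · rintro ⟨k, hk⟩
    have hkR : ∀ x ∈ range (N.route k), x ∉ R := fun x hx hxR => by
      have : x ∈ range (N.route k) ∩ R := ⟨hx, hxR⟩
      rwa [hk] at this
    have hs := hkR s (source_mem_range _)
    have ht := hkR t (target_mem_range _)
    -- Missing any route entails missing an outer one, since a half plane that meets both outer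
    -- routes meets everything they enclose.
    have hor : range (N.route i) ∩ R = ∅ ∨ range (N.route j) ∩ R = ∅ := by
      by_contra! h
      obtain ⟨⟨p, hp, hpR⟩, q, hq, hqR⟩ := h
      have hki : k ≠ i := by
        rintro rfl
        exact hkR p hp hpR
      have hkj : k ≠ j := by
        rintro rfl
        exact hkR q hq hqR
      obtain ⟨z, hz, hzR⟩ := meets_of_enclosed hst hK hS hT subset_hull_left subset_hull_right
        houter.simple_left houter.simple_right (houter.disjoint_left k hki)
        (houter.disjoint_right k hkj) (houter.enclosed k) hR hs ht hp hpR hq hqR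
      exact hkR z hz hzR
    rw [eq_empty_iff_forall_notMem]
    rintro p ⟨(hp | hp) | hp, hpR⟩
    · rcases hor with h | h
      · exact (h ▸ (⟨hp.1, hpR⟩ : p ∈ range (N.route i) ∩ R) : p ∈ (∅ : Set Plane))
      · exact notMem_of_mem_innerPart hR' h hp hpR
    · rcases hor with h | h
      · exact notMem_of_mem_innerPart hR' h hp hpR
      · exact (h ▸ (⟨hp.1, hpR⟩ : p ∈ range (N.route j) ∩ R) : p ∈ (∅ : Set Plane))
    · exact hR'.segment_subset hs ht hp hpR
  · intro h
    have hR0 : ∀ x ∈ innerPart (N.route i) (N.route j) ∪ innerPart (N.route j) (N.route i) ∪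
        segment ℝ s t, x ∉ R := fun x hx hxR => by
      have : x ∈ (innerPart (N.route i) (N.route j) ∪ innerPart (N.route j) (N.route i) ∪
        segment ℝ s t) ∩ R := ⟨hx, hxR⟩
      rwa [h] at this
    by_contra! hcon
    obtain ⟨p, hp, hpR⟩ := hcon i
    obtain ⟨q, hq, hqR⟩ := hcon j
    rcases between_segment_or hst hK hS hT subset_hull_left subset_hull_right hXY hR hR'
      (hR0 s (Or.inr (left_mem_segment ℝ s t))) (hR0 t (Or.inr (right_mem_segment ℝ s t)))
      hp hpR hq hqR with h | h
    · exact hR0 p (Or.inl (Or.inl ⟨hp, h⟩)) hpR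
    · exact hR0 q (Or.inl (Or.inr ⟨hq, h⟩)) hqR

/-- The perimeters of the hulls of the two inner parts add up. -/
lemma perimeter_innerParts (houter : N.IsOuterPair i j) (hconv : N.AlmostConvex i j) :
    perimeter (convexHull ℝ (innerPart (N.route i) (N.route j) ∪ segment ℝ s t)) +
        perimeter (convexHull ℝ (innerPart (N.route j) (N.route i) ∪ segment ℝ s t)) =
      perimeter (convexHull ℝ (innerPart (N.route i) (N.route j) ∪
        innerPart (N.route j) (N.route i) ∪ segment ℝ s t)) + perimeter (segment ℝ s t) := by
  have hst := houter.ne_ends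
  have hXY := houter.meetAtEnds
  set P := innerPart (N.route i) (N.route j) with hP
  set Q := innerPart (N.route j) (N.route i) with hQ
  have hseg : convexHull ℝ (segment ℝ s t) = segment ℝ s t := (convex_segment s t).convexHull_eq
  -- If an inner part is empty, its hull is the segment itself and both sides have the same terms.
  -- Only two nonempty parts determine sides of the line.
  rcases P.eq_empty_or_nonempty with hPe | ⟨p, hp⟩
  · rw [hPe, empty_union, empty_union, hseg, add_comm]
  rcases Q.eq_empty_or_nonempty with hQe | ⟨q, hq⟩
  · rw [hQe, union_empty, empty_union, hseg]
  set K := convexHull ℝ (range (N.route i) ∪ range (N.route j)) with hKdef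
  have hK : Convex ℝ K := convex_convexHull ℝ _
  have hKc : IsClosed K := isCompact_hull.isClosed
  have hPK : P ⊆ K := fun x hx => subset_hull_left hx.1
  have hQK : Q ⊆ K := fun x hx => subset_hull_right hx.1
  have hs : s ∈ K := subset_hull_left (source_mem_range _)
  have ht : t ∈ K := subset_hull_left (target_mem_range _)
  have hopp : ∀ x ∈ P, ∀ y ∈ Q, _ := fun x hx y hy =>
    innerPart_opposite hst hXY hconv.1.2 hconv.2.2 hx hy
  rcases hopp p hp q hq with h | h
  · refine perimeter_convexHull_add hst hK hKc hPK hQK hs ht (fun x hx => ?_) (fun y hy => ?_)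
      ⟨p, hp⟩ ⟨q, hq⟩ fun z hz hzs =>
        mem_segment_of_side_eq hK hst hs ht hconv.1.2 hconv.2.2 (hPK hp) (hQK hq) h.1 h.2 hz hzs
    · rcases hopp x hx q hq with h' | h'
      · exact h'.1
      · exact absurd h'.2 h.2.not_gt
    · rcases hopp p hp y hy with h' | h'
      · exact h'.2
      · exact absurd h'.1 h.1.not_gt
  · rw [add_comm, union_comm P Q]
    refine perimeter_convexHull_add hst hK hKc hQK hPK hs ht (fun y hy => ?_) (fun x hx => ?_)
      ⟨q, hq⟩ ⟨p, hp⟩ fun z hz hzs =>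
        mem_segment_of_side_eq hK hst hs ht hconv.1.2 hconv.2.2 (hQK hq) (hPK hp) h.2 h.1 hz hzs
    · rcases hopp p hp y hy with h' | h'
      · exact absurd h'.1 h.1.not_gt
      · exact h'.2
    · rcases hopp x hx q hq with h' | h'
      · exact absurd h'.2 h.2.not_gt
      · exact h'.1

end

end

theorem corollary2 {s t : Plane} (N : Network s t) (i j : Fin N.numRoutes)
    (houter : N.IsOuterPair i j) (hconv : N.AlmostConvex i j) :
    ∃ (γ : Path s t) (hγ : Rectifiable γ),
      ConsistsOfParts γ
        (innerPart (N.route i) (N.route j) ∪ innerPart (N.route j) (N.route i)) ∧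
      (∀ Ω : Set Plane, Convex ℝ Ω → Bornology.IsBounded Ω → N.carrier ⊆ Ω →
        (singleRoute γ hγ).carrier ⊆ Ω ∧
        ∀ r : ℝ, 0 < r → r < 1 →
          ∃ p : ℝ≥0∞, N.WeakestPr Ω r p ∧ (singleRoute γ hγ).WeakestPr Ω r p) ∧
      perimeter (convexHull ℝ (innerPart (N.route i) (N.route j) ∪ segment ℝ s t)) +
          perimeter (convexHull ℝ (innerPart (N.route j) (N.route i) ∪ segment ℝ s t)) =
        perimeter (convexHull ℝ (singleRoute γ hγ).carrier) + perimeter (segment ℝ s t) := by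
  have hst := houter.ne_ends
  obtain ⟨γ, hγ, hrange, hparts⟩ := exists_route_through_innerParts hst houter.meetAtEnds
    houter.simple_left houter.simple_right (N.route_rectifiable i) (N.route_rectifiable j)
  have hcar : (singleRoute γ hγ).carrier = range γ := by
    simp only [Network.carrier, singleRoute]
    exact iUnion_const _
  have hsub : ∀ k, range (N.route k) ⊆ N.carrier := fun k => by
    rw [N.range_route k]
    exact iUnion₂_subset fun l _ => subset_iUnion (fun l => range (N.link l)) l
  refine ⟨γ, hγ, hparts, fun Ω hΩ hb hN => ⟨?_, fun r hr0 hr1 => ?_⟩, ?_⟩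
  · rw [hcar, hrange]
    refine union_subset (union_subset ?_ ?_) ?_
    · exact fun x hx => hN (hsub i hx.1)
    · exact fun x hx => hN (hsub j hx.1)
    · exact hΩ.segment_subset (hN (hsub i (source_mem_range _))) (hN (hsub i (target_mem_range _)))
  · refine ⟨_, weakestPr_lineProb N hst hb hr0 hr1, ?_⟩
    convert weakestPr_lineProb (singleRoute γ hγ) hst hb hr0 hr1 using 3
    ext G
    refine (exists_route_avoids_iff houter hconv (convex_rightHalfPlane G)
      (convex_compl_rightHalfPlane G)).trans ?_
    rw [← hrange]
    exact ⟨fun h => ⟨(0 : Fin 1), h⟩, fun ⟨_, h⟩ => h⟩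
  · rw [hcar, hrange]
    exact perimeter_innerParts houter hconv
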